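/- **Mesh.** Let $\Omega\subset\mathbb R^2$ be an open connected non-empty set carrying a finite mixed mesh: finitely many vertices $V^{(i)}\in\mathbb R^2$ ($i\in\mathcal I_V$), edges $\mathcal E^{(i)}$ ($i\in\mathcal I_{\mathcal E}$), each an open segment $\{(1-t)V^{(i_0)}+tV^{(i_1)}:t\in(0,1)\}$ between two vertices, and open elements $\Omega^{(i)}$, $i\in\mathcal I_\triangle\,\dot\cup\,\mathcal I_\Box$, such that $\overline\Omega$ is the disjoint union of all elements, edges and vertices. The corners of each element are vertices of the mesh and its sides are edges of the mesh (no hanging vertices). A triangle ($i\in\mathcal I_\triangle$) with corners $V^{(i_1)},V^{(i_2)},V^{(i_3)}$ is the image of the interior of $\triangle_0=\{(u,v):0\le u\le1,\ 0\le v\le 1-u\}$ under $$F^{(i)}(u,v)=(1-u-v)V^{(i_1)}+uV^{(i_2)}+vV^{(i_3)},$$ and a quadrilateral ($i\in\mathcal I_\Box$) with consecutive corners $V^{(i_1)},\dots,V^{(i_4)}$ is the image of the interior of $\Box_0=[0,1]^2$ under $$F^{(i)}(u,v)=(1-u)(1-v)V^{(i_1)}+u(1-v)V^{(i_2)}+uvV^{(i_3)}+(1-u)vV^{(i_4)}.$$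 All $F^{(i)}$ are regular: $\det JF^{(i)}\neq0$ everywhere on $\triangle_0$, respectively $\Box_0$. For an edge from $V^{(i_0)}$ to $V^{(i_1)}$ with $V^{(i_1)}-V^{(i_0)}=(x,y)$ let $\mathbf n_i=(y,-x)/\|(x,y)\|$. **Space.** For an integer $p\ge 5$, $\mathcal A_p$ is the set of all $\varphi\in C^1(\overline\Omega)$ such that * $\varphi\circ F^{(i)}$ is a polynomial of total degree at most $p$ on $\triangle_0$ for $i\in\mathcal I_\triangle$, and of bi-degree at most $(p,p)$ on $\Box_0$ for $i\in\mathcal I_\Box$; * $\varphi$ is $C^2$ at every vertex (its second derivative relative to $\overline\Omega$ exists there and is the limit of the second derivatives on the open elements); * on each edge $\mathcal E^{(i)}$ the normal derivative $\partial_{\mathbf n_i}\varphi$ is a polynomial of degree at most $p-1$ in the parameter $t\in(0,1)$. Derivatives at boundary points are taken relative to $\overline\Omega$. **Points.** On each edge $\mathcal E^{(i)}$ choose $p-5$ pairwise different points $R^{(i)}_\ell\in\mathcal E^{(i)}$ and $p-4$ pairwise different points $S^{(i)}_\ell\in\mathcal E^{(i)}$. For each $i\in\mathcal I_\Box$ choose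 $(p-3)^2$ pairwise different points $\widehat Q^{(i)}_{\ell,k}\in\Box_0$ that are unisolvent in the span of the functions $B^p_{j_1}(u)B^p_{j_2}(v)$, $2\le j_1,j_2\le p-2$, where $B^p_j(u)=\binom pj u^j(1-u)^{p-j}$. For each $i\in\mathcal I_\triangle$ choose $\binom{p-4}2$ pairwise different points $\widehat Q^{(i)}_{\ell,k}\in\triangle_0$ that are unisolvent in the span of the functions $\frac{p!}{j_1!j_2!j_3!}u^{j_1}v^{j_2}(1-u-v)^{j_3}$, $j_1,j_2,j_3\ge2$, $j_1+j_2+j_3=p$. Unisolvent means that every function of the space is uniquely determined by its values at the points. Put $Q^{(i)}_{\ell,k}=F^{(i)}(\widehat Q^{(i)}_{\ell,k})$. **Theorem.** For all such meshes and choices of points and for arbitrary prescribed real values $\sigma_{i,a,b}$, $\sigma_{i,\ell}$, $w_{i,\ell}$, $\sigma^\Box_{i,\ell,k}$, $\sigma^\triangle_{i,\ell,k}$ there is exactly one function $\varphi\in\mathcal A_p$ on $\overline\Omega$ such that * (A) $D_x^aD_y^b\varphi(V^{(i)})=\sigma_{i,a,b}$ for all vertices and all $0\le a+b\le2$; * (B)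 $\varphi(R^{(i)}_\ell)=\sigma_{i,\ell}$ for $1\le\ell\le p-5$ and $\partial_{\mathbf n_i}\varphi(S^{(i)}_\ell)=w_{i,\ell}$ for $1\le\ell\le p-4$, for all edges; * (C) $\varphi(Q^{(i)}_{\ell,k})=\sigma^\Box_{i,\ell,k}$ for all $i\in\mathcal I_\Box$ and $1\le\ell,k\le p-3$; * (D) $\varphi(Q^{(i)}_{\ell,k})=\sigma^\triangle_{i,\ell,k}$ for all $i\in\mathcal I_\triangle$, $1\le\ell\le p-5$, $1\le k\le p-4-\ell$. -/

import Mathlib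

open Set Topology Filter

/-- The Euclidean plane. -/
abbrev Plane : Type := EuclideanSpace ℝ (Fin 2)

noncomputable section

namespace ArgyrisLike

/-! ### Parameter domains and element maps -/

/-- The closed parameter triangle `0 ≤ u ≤ 1`, `0 ≤ v ≤ 1 - u`. -/
def refTriangle : Set (ℝ × ℝ) := {x | x.1 ∈ Icc (0 : ℝ) 1 ∧ x.2 ∈ Icc (0 : ℝ) (1 - x.1)}

/-- The closed parameter square `[0,1]²`. -/
def refSquare : Set (ℝ × ℝ) := Icc (0 : ℝ) 1 ×ˢ Icc (0 : ℝ) 1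

/-- The linear (affine) parametrization of the triangle with corners `C 0, C 1, C 2`. -/
def triangleMap (C : Fin 3 → Plane) (x : ℝ × ℝ) : Plane :=
  (1 - x.1 - x.2) • C 0 + x.1 • C 1 + x.2 • C 2

/-- The bilinear parametrization of the quadrilateral with consecutive corners
`C 0, C 1, C 2, C 3`. -/
def quadMap (C : Fin 4 → Plane) (x : ℝ × ℝ) : Plane :=
  ((1 - x.1) * (1 - x.2)) • C 0 + (x.1 * (1 - x.2)) • C 1 + (x.1 * x.2) • C 2
    + ((1 - x.1) * x.2) • C 3

/-- The Jacobian determinant `det [∂F/∂u, ∂F/∂v]`. -/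
def jacobianDet (F : ℝ × ℝ → Plane) (x : ℝ × ℝ) : ℝ :=
  (fderiv ℝ F x (1, 0)) 0 * (fderiv ℝ F x (0, 1)) 1
    - (fderiv ℝ F x (1, 0)) 1 * (fderiv ℝ F x (0, 1)) 0

/-- A parametrization is regular on `D` if its Jacobian determinant vanishes nowhere on `D`. -/
def RegularOn (F : ℝ × ℝ → Plane) (D : Set (ℝ × ℝ)) : Prop :=
  ∀ x ∈ D, jacobianDet F x ≠ 0

/-! ### Mixed triangle and quadrilateral meshes -/

/-- The combinatorial and geometric data of a mesh: positions of the vertices, the two end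
points of every edge, and the corners of every triangle and of every quadrilateral (the
latter in cyclic order). -/
structure MeshData (ιV ιE ιT ιQ : Type*) where
  vertex : ιV → Plane
  edgeEnd : ιE → Fin 2 → ιV
  triCorner : ιT → Fin 3 → ιV
  quadCorner : ιQ → Fin 4 → ιV

namespace MeshData

variable {ιV ιE ιT ιQ : Type*}

/-- The relatively open edge with index `k`. -/
def edge (M : MeshData ιV ιE ιT ιQ) (k : ιE) : Set Plane :=
  openSegment ℝ (M.vertex (M.edgeEnd k 0)) (M.vertex (M.edgeEnd k 1))

/-- The parametrization of a triangle of the mesh. -/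
def triMap (M : MeshData ιV ιE ιT ιQ) (i : ιT) : ℝ × ℝ → Plane :=
  triangleMap fun j => M.vertex (M.triCorner i j)

/-- The parametrization of a quadrilateral of the mesh. -/
def quaMap (M : MeshData ιV ιE ιT ιQ) (i : ιQ) : ℝ × ℝ → Plane :=
  quadMap fun j => M.vertex (M.quadCorner i j)

/-- The open triangular element with index `i`. -/
def triangle (M : MeshData ιV ιE ιT ιQ) (i : ιT) : Set Plane :=
  M.triMap i '' interior refTriangle

/-- The open quadrilateral element with index `i`. -/
def quad (M : MeshData ιV ιE ιT ιQ) (i : ιQ) : Set Plane :=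
  M.quaMap i '' interior refSquare

/-- The family of all elements, edges and vertices (as one-point sets) of the mesh. -/
def cell (M : MeshData ιV ιE ιT ιQ) : (ιT ⊕ ιQ) ⊕ (ιE ⊕ ιV) → Set Plane :=
  Sum.elim (Sum.elim M.triangle M.quad) (Sum.elim M.edge fun i => {M.vertex i})

/-- The union of all (open) elements. -/
def elements (M : MeshData ιV ιE ιT ιQ) : Set Plane :=
  (⋃ i, M.triangle i) ∪ ⋃ i, M.quad i

/-- The mesh data form a mixed mesh of the domain `Ω`. -/
structure IsMixedMesh (M : MeshData ιV ιE ιT ιQ) (Ω : Set Plane) : Prop where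
  isOpen : IsOpen Ω
  isConnected : IsConnected Ω
  /-- the parametrizations of the elements are regular -/
  tri_regular : ∀ i, RegularOn (M.triMap i) refTriangle
  quad_regular : ∀ i, RegularOn (M.quaMap i) refSquare
  /-- the sides of the elements are edges of the mesh (no hanging vertices) -/
  tri_side : ∀ i j, ∃ k, M.edge k =
    openSegment ℝ (M.vertex (M.triCorner i j)) (M.vertex (M.triCorner i (j + 1)))
  quad_side : ∀ i j, ∃ k, M.edge k =
    openSegment ℝ (M.vertex (M.quadCorner i j)) (M.vertex (M.quadCorner i (j + 1)))
  /-- the closure of the domain is the disjoint union of elements, edges and vertices -/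
  disjoint : Pairwise fun c d => Disjoint (M.cell c) (M.cell d)
  cover : closure Ω = ⋃ c, M.cell c

/-- The unit normal `(y, -x) / ‖(x, y)‖` of an edge with direction `(x, y)`. -/
def normal (M : MeshData ιV ιE ιT ιQ) (k : ιE) : Plane :=
  let d : Plane := M.vertex (M.edgeEnd k 1) - M.vertex (M.edgeEnd k 0)
  ‖d‖⁻¹ • !₂[d 1, -d 0]

end MeshData

/-! ### The Argyris-like space

Functions on a closed set `K` are represented by functions on the whole plane; only the values
on `K` matter. The derivatives are those within `K` (one-sided at the boundary). -/

/-- The derivative within `K` in the direction `v`. -/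
def dirDeriv (K : Set Plane) (v : Plane) (f : Plane → ℝ) : Plane → ℝ :=
  fun x => fderivWithin ℝ f K x v

/-- The mixed partial derivative `D_x^a D_y^b f` within `K`. -/
def partialDeriv (K : Set Plane) (a b : ℕ) (f : Plane → ℝ) : Plane → ℝ :=
  (dirDeriv K !₂[1, 0])^[a] ((dirDeriv K !₂[0, 1])^[b] f)

/-- `f` is a bivariate polynomial of total degree at most `p` on `D`. -/
def IsPolyTotal (p : ℕ) (D : Set (ℝ × ℝ)) (f : ℝ × ℝ → ℝ) : Prop :=
  ∃ q : MvPolynomial (Fin 2) ℝ, q.totalDegree ≤ p ∧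
    ∀ x ∈ D, f x = MvPolynomial.eval ![x.1, x.2] q

/-- `f` is a bivariate polynomial of bi-degree at most `(p, p)` on `D`. -/
def IsPolyBi (p : ℕ) (D : Set (ℝ × ℝ)) (f : ℝ × ℝ → ℝ) : Prop :=
  ∃ q : MvPolynomial (Fin 2) ℝ, (∀ j, q.degreeOf j ≤ p) ∧
    ∀ x ∈ D, f x = MvPolynomial.eval ![x.1, x.2] q

namespace MeshData

variable {ιV ιE ιT ιQ : Type*}

/-- `φ`, a `C¹` function on `K`, is `C²` at the point `V`: its second derivative exists at `V`,
and the second derivatives on the open elements converge to it at `V`. -/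
def IsC2At (M : MeshData ιV ιE ιT ιQ) (K : Set Plane) (φ : Plane → ℝ) (V : Plane) : Prop :=
  DifferentiableWithinAt ℝ (fderivWithin ℝ φ K) K V ∧
    ContinuousWithinAt (fderivWithin ℝ (fderivWithin ℝ φ K) K) M.elements V

/-- Membership in the Argyris-like space of degree `p` over the mesh `M` of `Ω`. -/
structure MemArgyris (M : MeshData ιV ιE ιT ιQ) (Ω : Set Plane) (p : ℕ) (φ : Plane → ℝ) :
    Prop where
  c1 : ContDiffOn ℝ 1 φ (closure Ω)
  tri : ∀ i, IsPolyTotal p refTriangle (φ ∘ M.triMap i)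
  quad : ∀ i, IsPolyBi p refSquare (φ ∘ M.quaMap i)
  c2 : ∀ i, M.IsC2At (closure Ω) φ (M.vertex i)
  edge : ∀ k, ∃ q : Polynomial ℝ, q.natDegree ≤ p - 1 ∧ ∀ t ∈ Ioo (0 : ℝ) 1,
    dirDeriv (closure Ω) (M.normal k) φ
      ((1 - t) • M.vertex (M.edgeEnd k 0) + t • M.vertex (M.edgeEnd k 1)) = q.eval t

end MeshData

/-! ### Bernstein functions and unisolvence -/

/-- The univariate Bernstein function `binom(p, i) u^i (1 - u)^(p - i)`. -/
def bern (p i : ℕ) (u : ℝ) : ℝ := (p.choose i : ℝ) * u ^ i * (1 - u) ^ (p - i)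

/-- The tensor-product Bernstein function. -/
def bernQuad (p i j : ℕ) (x : ℝ × ℝ) : ℝ := bern p i x.1 * bern p j x.2

/-- The triangle Bernstein function (used for `i + j + k = p`). -/
def bernTri (p i j k : ℕ) (x : ℝ × ℝ) : ℝ :=
  (p.factorial : ℝ) / (i.factorial * j.factorial * k.factorial)
    * x.1 ^ i * x.2 ^ j * (1 - x.1 - x.2) ^ k

/-- The span of the interior tensor-product Bernstein functions. -/
def interiorQuad (p : ℕ) : Submodule ℝ (ℝ × ℝ → ℝ) :=
  Submodule.span ℝ {f | ∃ i j : ℕ, 2 ≤ i ∧ i ≤ p - 2 ∧ 2 ≤ j ∧ j ≤ p - 2 ∧ f = bernQuad p i j}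

/-- The span of the interior triangle Bernstein functions. -/
def interiorTri (p : ℕ) : Submodule ℝ (ℝ × ℝ → ℝ) :=
  Submodule.span ℝ {f | ∃ i j k : ℕ, 2 ≤ i ∧ 2 ≤ j ∧ 2 ≤ k ∧ i + j + k = p ∧ f = bernTri p i j k}

/-- A family of points is unisolvent in the space `W` if every function in `W` is uniquely
determined by its values at these points. -/
def Unisolvent {κ : Type*} (P : κ → ℝ × ℝ) (W : Submodule ℝ (ℝ × ℝ → ℝ)) : Prop :=
  ∀ g ∈ W, ∀ h ∈ W, (∀ k, g (P k) = h (P k)) → g = h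

/-! ### The interpolation problem -/

namespace MeshData

variable {ιV ιE ιT ιQ : Type*}

/-- An admissible choice of interpolation points: `R` and `S` on the edges, and the parameter
values `Q` (quadrilaterals) and `T` (triangles) of the points in the elements. -/
structure InterpPoints (M : MeshData ιV ιE ιT ιQ) (p : ℕ) where
  R : ιE → Fin (p - 5) → Plane
  S : ιE → Fin (p - 4) → Plane
  Q : ιQ → Fin (p - 3) × Fin (p - 3) → ℝ × ℝ
  T : ιT → Fin ((p - 4).choose 2) → ℝ × ℝ
  R_mem : ∀ k l, R k l ∈ M.edge k
  R_inj : ∀ k, Function.Injective (R k)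
  S_mem : ∀ k l, S k l ∈ M.edge k
  S_inj : ∀ k, Function.Injective (S k)
  Q_mem : ∀ i l, Q i l ∈ refSquare
  Q_inj : ∀ i, Function.Injective (Q i)
  Q_unisolvent : ∀ i, Unisolvent (Q i) (interiorQuad p)
  T_mem : ∀ i l, T i l ∈ refTriangle
  T_inj : ∀ i, Function.Injective (T i)
  T_unisolvent : ∀ i, Unisolvent (T i) (interiorTri p)

/-- Prescribed values; `σV i a b` is only used for `a + b ≤ 2`. -/
structure InterpValues (ιV ιE ιT ιQ : Type*) (p : ℕ) where
  σV : ιV → ℕ → ℕ → ℝ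
  σE : ιE → Fin (p - 5) → ℝ
  wE : ιE → Fin (p - 4) → ℝ
  σQ : ιQ → Fin (p - 3) × Fin (p - 3) → ℝ
  σT : ιT → Fin ((p - 4).choose 2) → ℝ

/-- The interpolation conditions. -/
structure Interpolates (M : MeshData ιV ιE ιT ιQ) (Ω : Set Plane) {p : ℕ}
    (P : M.InterpPoints p) (s : InterpValues ιV ιE ιT ιQ p) (φ : Plane → ℝ) : Prop where
  vertices : ∀ i a b, a + b ≤ 2 → partialDeriv (closure Ω) a b φ (M.vertex i) = s.σV i a b
  edge_values : ∀ k l, φ (P.R k l) = s.σE k l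
  edge_normals : ∀ k l, dirDeriv (closure Ω) (M.normal k) φ (P.S k l) = s.wE k l
  quads : ∀ i l, φ (M.quaMap i (P.Q i l)) = s.σQ i l
  triangles : ∀ i l, φ (M.triMap i (P.T i l)) = s.σT i l

end MeshData

end ArgyrisLike

end

/-!
The proof reduces the global problem to one problem per element, and solves that one by counting
dimensions.

On an element with parametrization `F`, a function is described by the polynomial `f = φ ∘ F` on
the reference domain. Its first and second derivatives in the physical variable are expressed in
the reference variable as `grad F f` and `hess F f`; by the chain rule they agree with the
derivatives within any set containing the element (`fderivWithin_eq_grad`).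

*Edges.* Along an edge the value is a polynomial of degree at most `p` and the normal derivative
one of degree at most `p - 1`. The data of order two at both end points and the `p - 5` and
`p - 4` interpolation points determine both, by counting zeros with multiplicity
(`jet_eq_zero_on_edge`). Hence pieces with the same data agree to first order along common edges,
and to second order at common vertices (`localSol_match`).

*Elements.* A polynomial that vanishes to first order on the boundary of the reference domain has
no Bernstein coefficients in the two outer layers (`mem_interiorQuad`, `mem_interiorTri`), so the
unisolvent interior points detect it. The local problem thus has at most one solution. For a
triangle, the number of conditions is the dimension of the space of polynomials of degree at most
`p`. For a quadrilateral, the normal derivative along a side is the quotient of a polynomial of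
degree at most `p` and the Jacobian determinant, an affine function without zeros there; that it
is a polynomial of degree at most `p - 1` follows from one linear equation per side
(`exists_normal_quad`). Together with these four equations there are again as many conditions as
dimensions. So the local problem is solvable (`Elem.exists_localSol`).

*Gluing.* The closed elements cover the closure of the domain (`closure_eq_iUnion`), and the
element maps are injective because their increments are given by the derivative at the midpoint
(`injOn_of_midpoint`). The local solutions therefore glue to a function on the closure of the
domain. It is continuously differentiable, and twice differentiable at the vertices, because it is
so within each of the finitely many closed elements, with matching derivatives (`exists_glued`).
-/

noncomputable section

namespace ArgyrisLike

/-! ### Univariate polynomials -/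

open Polynomial in
/-- A polynomial with zeros of order `r` at `0` and `1` and `m` further zeros in between vanishes
if its degree is smaller than `2 * r + m`. -/
theorem eq_zero_of_zeros {r m : ℕ} (q : ℝ[X]) (hdeg : q.natDegree < 2 * r + m)
    (h0 : ∀ i < r, (derivative^[i] q).eval 0 = 0) (h1 : ∀ i < r, (derivative^[i] q).eval 1 = 0)
    (t : Fin m → ℝ) (ht : Function.Injective t) (hI : ∀ l, t l ∈ Ioo (0 : ℝ) 1)
    (hz : ∀ l, q.eval (t l) = 0) : q = 0 := by
  by_contra hq
  have mult : ∀ a : ℝ, (∀ i < r, (derivative^[i] q).eval a = 0) → r ≤ q.rootMultiplicity a := by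
    intro a ha
    rcases Nat.eq_zero_or_pos r with rfl | hr
    · exact Nat.zero_le _
    · have := lt_rootMultiplicity_of_isRoot_iterate_derivative (t := a) (n := r - 1) hq
        (fun i hi => ha i (by omega))
      omega
  set s : Multiset ℝ := Multiset.replicate r 0 + Multiset.replicate r 1
    + (Finset.univ.val.map t) with hs
  have hnd : (Finset.univ.val.map t).Nodup := Finset.univ.nodup.map ht
  have hle : s ≤ q.roots := by
    rw [Multiset.le_iff_count]
    intro a
    rw [count_roots, hs, Multiset.count_add, Multiset.count_add, Multiset.count_replicate,
      Multiset.count_replicate]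
    by_cases hmem : a ∈ Finset.univ.val.map t
    · obtain ⟨l, -, rfl⟩ := Multiset.mem_map.1 hmem
      have h := hI l
      rw [if_neg h.1.ne, if_neg h.2.ne', Multiset.count_eq_one_of_mem hnd hmem]
      have : 0 < q.rootMultiplicity (t l) := (rootMultiplicity_pos hq).2 (hz l)
      omega
    · rw [Multiset.count_eq_zero_of_notMem hmem]
      by_cases ha0 : a = 0
      · subst ha0
        simpa using mult 0 h0
      · by_cases ha1 : a = 1
        · subst ha1
          simpa using mult 1 h1
        · rw [if_neg (Ne.symm ha0), if_neg (Ne.symm ha1)]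
          simp
  have hc := Multiset.card_le_card hle
  have hr := q.card_roots'
  simp [hs] at hc
  omega

open Polynomial in
/-- Divisibility of polynomials of degree at most `p` by a fixed nonzero affine polynomial is
implied by the vanishing of one linear functional. For `β = 0` this functional is the leading
coefficient, as the quotient is required to have degree at most `p - 1`. -/
theorem exists_functional_dvd {p : ℕ} (hp : 1 ≤ p) {α β : ℝ} (h : α ≠ 0 ∨ β ≠ 0) :
    ∃ L : (ℝ → ℝ) →ₗ[ℝ] ℝ, ∀ N : ℝ[X], N.natDegree ≤ p → L (fun t => N.eval t) = 0 →
      ∃ q : ℝ[X], q.natDegree ≤ p - 1 ∧ ∀ t, N.eval t = (α + β * t) * q.eval t := by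
  by_cases hβ : β = 0
  · have hα : α ≠ 0 := by simpa [hβ] using h
    let ι : ℝ[X] →ₗ[ℝ] (ℝ → ℝ) :=
      { toFun := fun N t => N.eval t
        map_add' := fun a b => by ext; simp
        map_smul' := fun c a => by ext; simp }
    have hι : LinearMap.ker ι = ⊥ := by
      rw [LinearMap.ker_eq_bot]
      intro a b hab
      exact Polynomial.funext fun r => congrFun hab r
    -- A left inverse of `ι` extends the coefficient functional to all functions on `ℝ`.
    obtain ⟨ρ, hρ⟩ := LinearMap.exists_leftInverse_of_injective ι hι
    refine ⟨(lcoeff ℝ p).comp ρ, fun N hN hL => ⟨C α⁻¹ * N, ?_, fun t => ?_⟩⟩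
    · have hρN : ρ (fun t => N.eval t) = N := LinearMap.congr_fun hρ N
      rw [LinearMap.comp_apply, hρN, lcoeff_apply] at hL
      refine (natDegree_C_mul_le _ _).trans ?_
      by_contra hlt
      have : N.natDegree = p := by omega
      rw [← this, coeff_natDegree, leadingCoeff_eq_zero] at hL
      subst hL
      simp at this
      omega
    · simp [hβ]
      field_simp
  · refine ⟨LinearMap.proj (-α / β), fun N hN hL => ?_⟩
    have hroot : N.IsRoot (-α / β) := hL
    obtain ⟨q, hq⟩ := dvd_iff_isRoot.2 hroot
    refine ⟨C β⁻¹ * q, (natDegree_C_mul_le _ _).trans ?_, fun t => ?_⟩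
    · by_cases hq0 : q = 0
      · simp [hq0]
      · rw [hq, natDegree_mul (X_sub_C_ne_zero _) hq0, natDegree_X_sub_C] at hN
        omega
    · rw [hq]
      simp
      field_simp
      ring

/-- Linear independence of the functions `t ^ i * (1 - t) ^ (n - i)`. -/
theorem coeff_eq_zero_of_sum_bernstein {n : ℕ} {c : ℕ → ℝ}
    (h : ∀ t ∈ Ioo (0 : ℝ) 1, ∑ i ∈ Finset.range (n + 1), c i * (t ^ i * (1 - t) ^ (n - i)) = 0) :
    ∀ i ≤ n, c i = 0 := by
  set q : Polynomial ℝ := ∑ i ∈ Finset.range (n + 1), Polynomial.C (c i) * Polynomial.X ^ i with hq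
  -- The substitution `s = t / (1 - t)` turns the sum into a polynomial with infinitely many zeros.
  have hz : ∀ s ∈ Ioi (0 : ℝ), q.eval s = 0 := by
    intro s hs
    have hs0 : 0 < s := hs
    have h1 : (0 : ℝ) < 1 + s := by linarith
    have key := h (s / (1 + s)) ⟨by positivity, by rw [div_lt_one h1]; linarith⟩
    have e : (1 : ℝ) - s / (1 + s) = 1 / (1 + s) := by field_simp; ring
    have : ∑ i ∈ Finset.range (n + 1), c i * ((s / (1 + s)) ^ i * (1 - s / (1 + s)) ^ (n - i))
        = (1 / (1 + s)) ^ n * q.eval s := by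
      rw [hq, Polynomial.eval_finsetSum, Finset.mul_sum]
      refine Finset.sum_congr rfl fun i hi => ?_
      have hi' : i ≤ n := Nat.lt_succ_iff.1 (Finset.mem_range.1 hi)
      rw [e]
      have hn : (1 / (1 + s)) ^ n = (1 / (1 + s)) ^ i * (1 / (1 + s)) ^ (n - i) := by
        rw [← pow_add, Nat.add_sub_cancel' hi']
      simp only [Polynomial.eval_mul, Polynomial.eval_C, Polynomial.eval_pow, Polynomial.eval_X]
      rw [hn, div_eq_mul_one_div s, mul_pow]
      ring
    rw [this] at key
    exact (mul_eq_zero.1 key).resolve_left (by positivity)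
  have hq0 : q = 0 := Polynomial.eq_zero_of_infinite_isRoot q
    ((Ioi_infinite (0 : ℝ)).mono fun s hs => hz s hs)
  intro i hi
  have := congrArg (fun r => Polynomial.coeff r i) hq0
  simpa [hq, Polynomial.finsetSum_coeff, Polynomial.coeff_C_mul, Polynomial.coeff_X_pow,
    Nat.lt_succ_iff, hi] using this

/-! ### Derivatives in the physical variable -/

section Jets

variable {G : Type*} [NormedAddCommGroup G] [NormedSpace ℝ G]
variable {F : ℝ × ℝ → Plane} {D : Set (ℝ × ℝ)} {x : ℝ × ℝ}

/-- The derivative of `f ∘ F⁻¹` at `F x`, written in the reference variable `x`. It is only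
meaningful where the derivative of `F` is invertible. -/
def grad (F : ℝ × ℝ → Plane) (f : ℝ × ℝ → G) (x : ℝ × ℝ) : Plane →L[ℝ] G :=
  (fderiv ℝ f x).comp (fderiv ℝ F x).inverse

/-- The second derivative of `f ∘ F⁻¹` at `F x`, written in the reference variable `x`. -/
def hess (F : ℝ × ℝ → Plane) (f : ℝ × ℝ → G) : ℝ × ℝ → Plane →L[ℝ] Plane →L[ℝ] G :=
  grad F (grad F f)

theorem inverse_apply_fderiv (hx : (fderiv ℝ F x).IsInvertible) (v : ℝ × ℝ) :
    (fderiv ℝ F x).inverse (fderiv ℝ F x v) = v := by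
  obtain ⟨e, he⟩ := hx
  rw [← he]
  simp

theorem fderiv_apply_inverse (hx : (fderiv ℝ F x).IsInvertible) (w : Plane) :
    fderiv ℝ F x ((fderiv ℝ F x).inverse w) = w := by
  obtain ⟨e, he⟩ := hx
  rw [← he]
  simp

theorem grad_apply_fderiv (f : ℝ × ℝ → G) (hx : (fderiv ℝ F x).IsInvertible) (v : ℝ × ℝ) :
    grad F f x (fderiv ℝ F x v) = fderiv ℝ f x v := by
  simp [grad, inverse_apply_fderiv hx]

theorem contDiffAt_grad {f : ℝ × ℝ → G} {n : WithTop ℕ∞} (hF : ContDiffAt ℝ (n + 1) F x)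
    (hf : ContDiffAt ℝ (n + 1) f x) (hx : (fderiv ℝ F x).IsInvertible) :
    ContDiffAt ℝ n (grad F f) x := by
  have h1 : ContDiffAt ℝ n (fderiv ℝ f) x := hf.fderiv_right le_rfl
  have h2 : ContDiffAt ℝ n (fderiv ℝ F) x := hF.fderiv_right le_rfl
  obtain ⟨e, he⟩ := hx
  have h0 : ContDiffAt ℝ n ContinuousLinearMap.inverse (fderiv ℝ F x) := by
    rw [← he]
    exact contDiffAt_map_inverse e
  have h3 : ContDiffAt ℝ n (fun y => (fderiv ℝ F y).inverse) x := ContDiffAt.comp x h0 h2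
  exact h1.clm_comp h3

theorem grad_add {f g : ℝ × ℝ → G} (hf : DifferentiableAt ℝ f x) (hg : DifferentiableAt ℝ g x) :
    grad F (f + g) x = grad F f x + grad F g x := by
  simp [grad, fderiv_add hf hg]

theorem grad_smul (c : ℝ) {f : ℝ × ℝ → G} (hf : DifferentiableAt ℝ f x) :
    grad F (c • f) x = c • grad F f x := by
  simp [grad, fderiv_const_smul hf c]

theorem hess_add {f g : ℝ × ℝ → ℝ} (hF : ContDiff ℝ 2 F) (hf : ContDiff ℝ 2 f)
    (hg : ContDiff ℝ 2 g) (hx : (fderiv ℝ F x).IsInvertible) :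
    hess F (f + g) x = hess F f x + hess F g x := by
  have h : grad F (f + g) = grad F f + grad F g := by
    ext1 y
    exact grad_add (hf.differentiable (by norm_num) y) (hg.differentiable (by norm_num) y)
  rw [hess, h]
  exact grad_add ((contDiffAt_grad (n := 1) hF.contDiffAt hf.contDiffAt hx).differentiableAt (by norm_num))
    ((contDiffAt_grad (n := 1) hF.contDiffAt hg.contDiffAt hx).differentiableAt (by norm_num))

theorem hess_smul (c : ℝ) {f : ℝ × ℝ → ℝ} (hF : ContDiff ℝ 2 F) (hf : ContDiff ℝ 2 f)
    (hx : (fderiv ℝ F x).IsInvertible) :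
    hess F (c • f) x = c • hess F f x := by
  have h : grad F (c • f) = c • grad F f := by
    ext1 y
    exact grad_smul c (hf.differentiable (by norm_num) y)
  rw [hess, h]
  exact grad_smul c
    ((contDiffAt_grad (n := 1) hF.contDiffAt hf.contDiffAt hx).differentiableAt (by norm_num))

theorem hess_symm {f : ℝ × ℝ → ℝ} (hF : ContDiff ℝ 2 F) (hf : ContDiff ℝ 2 f)
    (hx : (fderiv ℝ F x).IsInvertible) (a b : Plane) : hess F f x a b = hess F f x b a := by
  have hF1 : Differentiable ℝ (fderiv ℝ F) :=
    (hF.fderiv_right (m := 1) (by norm_num)).differentiable (by norm_num)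
  have hA : DifferentiableAt ℝ (grad F f) x :=
    (contDiffAt_grad (n := 1) hF.contDiffAt hf.contDiffAt hx).differentiableAt (by norm_num)
  -- Differentiate the identity `Df = grad ∘ DF`, which holds near `x`.
  have hev : fderiv ℝ f =ᶠ[𝓝 x] fun y => (grad F f y).comp (fderiv ℝ F y) := by
    have hopen : ∀ᶠ y in 𝓝 x, (fderiv ℝ F y).IsInvertible := by
      obtain ⟨e, he⟩ := hx
      have hc : ContinuousAt (fderiv ℝ F) x := (hF1 x).continuousAt
      have hN := ContinuousLinearEquiv.nhds e
      rw [he] at hN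
      exact hc hN
    filter_upwards [hopen] with y hy
    exact ContinuousLinearMap.ext fun v => (grad_apply_fderiv f hy v).symm
  have hd : fderiv ℝ (fderiv ℝ f) x = _ :=
    hev.fderiv_eq.trans (hA.hasFDerivAt.clm_comp (hF1 x).hasFDerivAt).fderiv
  have sf : ∀ v w, fderiv ℝ (fderiv ℝ f) x v w = fderiv ℝ (fderiv ℝ f) x w v := fun v w =>
    (hf.contDiffAt.isSymmSndFDerivAt (x := x) (by simp)) v w
  have sF : ∀ v w, fderiv ℝ (fderiv ℝ F) x v w = fderiv ℝ (fderiv ℝ F) x w v := fun v w =>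
    (hF.contDiffAt.isSymmSndFDerivAt (x := x) (by simp)) v w
  have key : ∀ v w, fderiv ℝ (fderiv ℝ f) x v w = hess F f x (fderiv ℝ F x v) (fderiv ℝ F x w)
      + grad F f x (fderiv ℝ (fderiv ℝ F) x v w) := by
    intro v w
    rw [hess, grad_apply_fderiv _ hx v, hd]
    simp [add_comm]
  have h1 := key ((fderiv ℝ F x).inverse a) ((fderiv ℝ F x).inverse b)
  have h2 := key ((fderiv ℝ F x).inverse b) ((fderiv ℝ F x).inverse a)
  rw [fderiv_apply_inverse hx, fderiv_apply_inverse hx] at h1 h2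
  rw [sf, sF, h2] at h1
  linarith

/-- A derivative within any set containing `F '' D` is determined by the pull-back to `D`. -/
theorem fderivWithin_eq_grad {K : Set Plane} {ψ : Plane → G} {f : ℝ × ℝ → G}
    (hF : DifferentiableAt ℝ F x) (hf : DifferentiableAt ℝ f x)
    (hx : (fderiv ℝ F x).IsInvertible) (hD : UniqueDiffWithinAt ℝ D x) (hxD : x ∈ D)
    (hK : MapsTo F D K) (hψ : DifferentiableWithinAt ℝ ψ K (F x)) (h : ∀ y ∈ D, ψ (F y) = f y) :
    fderivWithin ℝ ψ K (F x) = grad F f x := by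
  have h1 : HasFDerivWithinAt (ψ ∘ F) ((fderivWithin ℝ ψ K (F x)).comp (fderiv ℝ F x)) D x :=
    hψ.hasFDerivWithinAt.comp x hF.hasFDerivAt.hasFDerivWithinAt hK
  have h2 : HasFDerivWithinAt (ψ ∘ F) (fderiv ℝ f x) D x :=
    hf.hasFDerivAt.hasFDerivWithinAt.congr (fun y hy => h y hy) (h x hxD)
  have h3 := hD.eq h1 h2
  ext1 w
  rw [← fderiv_apply_inverse hx w, grad_apply_fderiv f hx, ← h3]
  rfl

/-- The inverse of a continuous injective map on a compact set is continuous. -/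
theorem continuousOn_invFunOn_image (hF : ContinuousOn F D) (hD : IsCompact D)
    (hinj : InjOn F D) : ContinuousOn (Function.invFunOn F D) (F '' D) := by
  rw [continuousOn_iff_isClosed]
  intro t ht
  refine ⟨F '' (D ∩ t), ((hD.inter_right ht).image_of_continuousOn
    (hF.mono inter_subset_left)).isClosed, ?_⟩
  ext y
  constructor
  · rintro ⟨hy, z, hz, rfl⟩
    rw [mem_preimage, hinj.leftInvOn_invFunOn hz] at hy
    exact ⟨⟨z, ⟨hz, hy⟩, rfl⟩, ⟨z, hz, rfl⟩⟩
  · rintro ⟨⟨z, ⟨hz, hzt⟩, rfl⟩, -⟩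
    refine ⟨?_, ⟨z, hz, rfl⟩⟩
    rw [mem_preimage, hinj.leftInvOn_invFunOn hz]
    exact hzt

theorem continuousOn_of_comp {G : Type*} [TopologicalSpace G] {φ : Plane → G} {f : ℝ × ℝ → G}
    (hF : ContinuousOn F D)
    (hD : IsCompact D) (hinj : InjOn F D) (hf : ContinuousOn f D)
    (h : ∀ y ∈ D, φ (F y) = f y) : ContinuousOn φ (F '' D) := by
  have hm : MapsTo (Function.invFunOn F D) (F '' D) D := by
    rintro _ ⟨z, hz, rfl⟩
    rw [hinj.leftInvOn_invFunOn hz]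
    exact hz
  refine (hf.comp (continuousOn_invFunOn_image hF hD hinj) hm).congr ?_
  rintro _ ⟨z, hz, rfl⟩
  rw [h z hz, Function.comp_apply, hinj.leftInvOn_invFunOn hz]

/-- A function on `F '' D` with a differentiable pull-back is differentiable within `F '' D`. -/
theorem hasFDerivWithinAt_of_comp {φ : Plane → G} {f : ℝ × ℝ → G} (hF : Differentiable ℝ F)
    (hD : IsCompact D) (hinj : InjOn F D) (hxD : x ∈ D) (hf : DifferentiableAt ℝ f x)
    (hx : (fderiv ℝ F x).IsInvertible) (h : ∀ y ∈ D, φ (F y) = f y) :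
    HasFDerivWithinAt φ (grad F f x) (F '' D) (F x) := by
  have hl := hinj.leftInvOn_invFunOn
  have hc := continuousOn_invFunOn_image hF.continuous.continuousOn hD hinj
  have hmem : F x ∈ F '' D := ⟨x, hxD, rfl⟩
  have hG : HasFDerivWithinAt (Function.invFunOn F D) (fderiv ℝ F x).inverse (F '' D) (F x) := by
    obtain ⟨e, he⟩ := hx
    rw [← he, ContinuousLinearMap.inverse_equiv]
    refine HasFDerivWithinAt.of_local_left_inverse (f := F) (t := univ) ?_ ?_ hmem ?_
    · rw [nhdsWithin_univ]
      exact hc _ hmem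
    · rw [hl hxD, he]
      exact (hF x).hasFDerivAt.hasFDerivWithinAt
    · filter_upwards [self_mem_nhdsWithin] with y hy
      exact Function.invFunOn_eq hy
  have h2 : HasFDerivWithinAt (f ∘ Function.invFunOn F D) (grad F f x) (F '' D) (F x) := by
    refine HasFDerivAt.comp_hasFDerivWithinAt (F x) ?_ hG
    rw [hl hxD]
    exact hf.hasFDerivAt
  have e : ∀ y ∈ D, φ (F y) = (f ∘ Function.invFunOn F D) (F y) := fun y hy => by
    rw [h y hy, Function.comp_apply, hl hy]
  exact h2.congr (by rintro _ ⟨z, hz, rfl⟩; exact e z hz) (e x hxD)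

end Jets

/-! ### Jets along an edge -/

/-- A functional on the plane vanishes if it vanishes on a vector `d ≠ 0` and on its normal. -/
theorem clm_ext_plane {d : Plane} (hd : d ≠ 0) {c : ℝ} (hc : c ≠ 0) {L : Plane →L[ℝ] ℝ}
    (h1 : L d = 0) (h2 : L (c • !₂[d 1, -d 0]) = 0) : L = 0 := by
  have hn : d 0 ^ 2 + d 1 ^ 2 ≠ 0 := by
    intro h
    apply hd
    ext i
    fin_cases i <;> simp <;> nlinarith [sq_nonneg (d 0), sq_nonneg (d 1)]
  rw [map_smul, smul_eq_mul] at h2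
  have h2 := (mul_eq_zero.1 h2).resolve_left hc
  ext w
  have : w = ((w 0 * d 0 + w 1 * d 1) / (d 0 ^ 2 + d 1 ^ 2)) • d
      + ((w 0 * d 1 - w 1 * d 0) / (d 0 ^ 2 + d 1 ^ 2)) • (!₂[d 1, -d 0] : Plane) := by
    ext i
    fin_cases i <;> simp <;> field_simp <;> ring
  rw [this, map_add, map_smul, map_smul, h1, h2]
  simp

/-- Uniqueness of the first-order jet along an edge: a value `a` of degree at most `p` and a
gradient `A` whose normal component has degree at most `p - 1` vanish if their 2-jets vanish at
both ends and there are `p - 5`, respectively `p - 4`, further zeros. -/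
theorem jet_eq_zero_on_edge {p : ℕ} (hp : 5 ≤ p) {a : ℝ → ℝ} {A : ℝ → Plane →L[ℝ] ℝ}
    {d n : Plane} (hdn : ∀ L : Plane →L[ℝ] ℝ, L d = 0 → L n = 0 → L = 0)
    (ha : ∃ q : Polynomial ℝ, q.natDegree ≤ p ∧ ∀ t, a t = q.eval t)
    (hder : ∀ t ∈ Icc (0 : ℝ) 1, HasDerivAt a (A t d) t)
    (hA : ∃ q : Polynomial ℝ, q.natDegree ≤ p - 1 ∧ ∀ t ∈ Ioo (0 : ℝ) 1, A t n = q.eval t)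
    (h0 : a 0 = 0) (h0' : A 0 = 0) (h0'' : HasDerivAt A 0 0)
    (h1 : a 1 = 0) (h1' : A 1 = 0) (h1'' : HasDerivAt A 0 1)
    (R : Fin (p - 5) → ℝ) (hR : Function.Injective R) (hRI : ∀ l, R l ∈ Ioo (0 : ℝ) 1)
    (hRz : ∀ l, a (R l) = 0)
    (S : Fin (p - 4) → ℝ) (hS : Function.Injective S) (hSI : ∀ l, S l ∈ Ioo (0 : ℝ) 1)
    (hSz : ∀ l, A (S l) n = 0) :
    ∀ t ∈ Icc (0 : ℝ) 1, a t = 0 ∧ A t = 0 := by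
  have m0 : (0 : ℝ) ∈ Icc (0 : ℝ) 1 := by simp
  have m1 : (1 : ℝ) ∈ Icc (0 : ℝ) 1 := by simp
  have hu := uniqueDiffOn_Icc (zero_lt_one (α := ℝ))
  -- A polynomial agreeing with a component of `A` on `[0, 1]` inherits its derivatives.
  have hpoly : ∀ (q : Polynomial ℝ) (w : Plane), (∀ t ∈ Icc (0 : ℝ) 1, A t w = q.eval t) →
      q.eval 0 = 0 ∧ q.derivative.eval 0 = 0 ∧ q.eval 1 = 0 ∧ q.derivative.eval 1 = 0 := by
    intro q w h
    have aux : ∀ s ∈ Icc (0 : ℝ) 1, HasDerivAt A 0 s → q.derivative.eval s = 0 := by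
      intro s hs hAs
      have e1 : HasDerivWithinAt (fun t => A t w) 0 (Icc 0 1) s := by
        simpa using (hAs.clm_apply (hasDerivAt_const s w)).hasDerivWithinAt
      have e2 : HasDerivWithinAt (fun t => A t w) (q.derivative.eval s) (Icc 0 1) s :=
        (q.hasDerivAt s).hasDerivWithinAt.congr h (h s hs)
      exact (hu s hs).eq_deriv _ e2 e1
    refine ⟨?_, aux 0 m0 h0'', ?_, aux 1 m1 h1''⟩
    · rw [← h 0 m0, h0']; rfl
    · rw [← h 1 m1, h1']; rfl
  obtain ⟨q, hq, hqa⟩ := ha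
  have hqd : ∀ t ∈ Icc (0 : ℝ) 1, A t d = q.derivative.eval t := by
    intro t ht
    refine (hder t ht).unique ?_
    have : a = fun t => q.eval t := funext hqa
    rw [this]
    exact q.hasDerivAt t
  obtain ⟨q0, q0', q1, q1'⟩ := hpoly _ d hqd
  have hq0 : q = 0 := by
    refine eq_zero_of_zeros (r := 3) (m := p - 5) q (by omega) ?_ ?_ R hR hRI
      (fun l => by rw [← hqa, hRz])
    · intro i hi
      interval_cases i
      · simpa [← hqa] using h0
      · simpa using q0
      · simpa using q0'
    · intro i hi
      interval_cases i
      · simpa [← hqa] using h1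
      · simpa using q1
      · simpa using q1'
  obtain ⟨r, hr, hrA⟩ := hA
  have hrA' : ∀ t ∈ Icc (0 : ℝ) 1, A t n = r.eval t := by
    have ext : ∀ s ∈ Icc (0 : ℝ) 1, HasDerivAt A 0 s → A s n = r.eval s := by
      intro s hs hAs
      have hne : (𝓝[Ioo (0 : ℝ) 1] s).NeBot := by
        rw [← mem_closure_iff_nhdsWithin_neBot, closure_Ioo (zero_ne_one)]
        exact hs
      have c1 : Tendsto (fun t => A t n) (𝓝[Ioo (0 : ℝ) 1] s) (𝓝 (A s n)) :=
        (hAs.continuousAt.clm_apply continuousAt_const).continuousWithinAt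
      have c2 : Tendsto (fun t => r.eval t) (𝓝[Ioo (0 : ℝ) 1] s) (𝓝 (r.eval s)) :=
        r.continuous.continuousWithinAt
      refine tendsto_nhds_unique c1 (c2.congr' ?_)
      filter_upwards [self_mem_nhdsWithin] with t ht using (hrA t ht).symm
    intro t ht
    rcases eq_or_lt_of_le ht.1 with rfl | ht0
    · exact ext 0 m0 h0''
    rcases eq_or_lt_of_le ht.2 with rfl | ht1
    · exact ext 1 m1 h1''
    exact hrA t ⟨ht0, ht1⟩
  obtain ⟨r0, r0', r1, r1'⟩ := hpoly _ n hrA'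
  have hr0 : r = 0 := by
    refine eq_zero_of_zeros (r := 2) (m := p - 4) r (by omega) ?_ ?_ S hS hSI
      (fun l => by rw [← hrA _ (hSI l), hSz])
    · intro i hi
      interval_cases i
      · simpa using r0
      · simpa using r0'
    · intro i hi
      interval_cases i
      · simpa using r1
      · simpa using r1'
  intro t ht
  refine ⟨by rw [hqa, hq0]; simp, hdn _ ?_ ?_⟩
  · rw [hqd t ht, hq0]; simp
  · rw [hrA' t ht, hr0]; simp

/-! ### Elements and their local interpolation problem -/

section Elements

variable {ιV ιE ιT ιQ : Type*} {M : MeshData ιV ιE ιT ιQ} {p : ℕ}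

theorem hasDerivAt_segment {V : Type*} [NormedAddCommGroup V] [NormedSpace ℝ V] (a b : V)
    (t : ℝ) : HasDerivAt (fun t : ℝ => (1 - t) • a + t • b) (b - a) t := by
  have h := (((hasDerivAt_id t).const_sub 1).smul_const a).add
    ((hasDerivAt_id t).smul_const b)
  have e : b - a = (-1 : ℝ) • a + (1 : ℝ) • b := by module
  rw [e]
  exact h

/-- The point with parameter `t` on the edge `k`. -/
def MeshData.edgePoint (M : MeshData ιV ιE ιT ιQ) (k : ιE) (t : ℝ) : Plane :=
  (1 - t) • M.vertex (M.edgeEnd k 0) + t • M.vertex (M.edgeEnd k 1)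

/-- What triangles and quadrilaterals of a mesh have in common: a parametrization `F` of the
element over a reference domain `D`, the corners and sides of `D` (side `j` is parametrized from
corner `st j` to corner `en j`, in the direction of the mesh edge it is mapped to), interior
interpolation points, and the space `Pol` of polynomials pulled back to `D`. The condition on
normal derivatives is implied by the vanishing of the `m` functionals `lam`, and `finrank_pol`
says that `Pol` has as many dimensions as there are interpolation conditions and functionals. -/
structure Elem (M : MeshData ιV ιE ιT ιQ) (p : ℕ) where
  F : ℝ × ℝ → Plane
  D : Set (ℝ × ℝ)
  smooth : ContDiff ℝ 2 F
  compact : IsCompact D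
  uniqueDiff : UniqueDiffOn ℝ D
  invertible : ∀ x ∈ D, (fderiv ℝ F x).IsInvertible
  inj : InjOn F D
  n : ℕ
  corner : Fin n → ℝ × ℝ
  corner_mem : ∀ j, corner j ∈ D
  vtx : Fin n → ιV
  map_corner : ∀ j, F (corner j) = M.vertex (vtx j)
  st : Fin n → Fin n
  en : Fin n → Fin n
  edgeIdx : Fin n → ιE
  vtx_st : ∀ j, vtx (st j) = M.edgeEnd (edgeIdx j) 0
  vtx_en : ∀ j, vtx (en j) = M.edgeEnd (edgeIdx j) 1
  side_mem : ∀ j, ∀ t ∈ Icc (0 : ℝ) 1, (1 - t) • corner (st j) + t • corner (en j) ∈ D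
  map_side : ∀ j (t : ℝ), F ((1 - t) • corner (st j) + t • corner (en j))
    = M.edgePoint (edgeIdx j) t
  decomp : ∀ x ∈ D, x ∈ interior D ∨
    (∃ j, ∃ t ∈ Ioo (0 : ℝ) 1, x = (1 - t) • corner (st j) + t • corner (en j)) ∨
    ∃ j, x = corner j
  κ : Type
  fintypePt : Fintype κ
  pt : κ → ℝ × ℝ
  pt_mem : ∀ l, pt l ∈ D
  Pol : Submodule ℝ (ℝ × ℝ → ℝ)
  finite_pol : FiniteDimensional ℝ Pol
  smooth_pol : ∀ f ∈ Pol, ContDiff ℝ 2 f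
  trace_pol : ∀ f ∈ Pol, ∀ j, ∃ q : Polynomial ℝ, q.natDegree ≤ p ∧
    ∀ t : ℝ, f ((1 - t) • corner (st j) + t • corner (en j)) = q.eval t
  unisolvent_pol : ∀ f ∈ Pol, (∀ j, ∀ t ∈ Icc (0 : ℝ) 1,
      f ((1 - t) • corner (st j) + t • corner (en j)) = 0 ∧
      fderiv ℝ f ((1 - t) • corner (st j) + t • corner (en j)) = 0) →
    (∀ l, f (pt l) = 0) → f = 0
  m : ℕ
  lam : Fin m → Pol →ₗ[ℝ] ℝ
  normal_pol : ∀ f : Pol, (∀ i, lam i f = 0) → ∀ j, ∃ q : Polynomial ℝ, q.natDegree ≤ p - 1 ∧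
    ∀ t ∈ Ioo (0 : ℝ) 1, grad F f.1 ((1 - t) • corner (st j) + t • corner (en j))
      (M.normal (edgeIdx j)) = q.eval t
  finrank_pol : Module.finrank ℝ Pol
    = n * 6 + (n * ((p - 5) + (p - 4)) + (Fintype.card κ + m))

attribute [instance] Elem.fintypePt Elem.finite_pol

namespace Elem

/-- The parametrization of side `j` of the reference domain. -/
def side (e : Elem M p) (j : Fin e.n) (t : ℝ) : ℝ × ℝ :=
  (1 - t) • e.corner (e.st j) + t • e.corner (e.en j)

theorem side_zero (e : Elem M p) (j : Fin e.n) : e.side j 0 = e.corner (e.st j) := by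
  simp [side]

theorem side_one (e : Elem M p) (j : Fin e.n) : e.side j 1 = e.corner (e.en j) := by
  simp [side]

theorem hasDerivAt_side (e : Elem M p) (j : Fin e.n) (t : ℝ) :
    HasDerivAt (e.side j) (e.corner (e.en j) - e.corner (e.st j)) t :=
  hasDerivAt_segment _ _ t

theorem mem_side (e : Elem M p) (j : Fin e.n) {t : ℝ} (ht : t ∈ Icc (0 : ℝ) 1) :
    e.side j t ∈ e.D :=
  e.side_mem j t ht

theorem differentiable (e : Elem M p) : Differentiable ℝ e.F :=
  e.smooth.differentiable (by norm_num)

theorem differentiable_pol (e : Elem M p) {f : ℝ × ℝ → ℝ} (hf : f ∈ e.Pol) :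
    Differentiable ℝ f :=
  (e.smooth_pol f hf).differentiable (by norm_num)

theorem contDiffAt_grad_pol (e : Elem M p) {f : ℝ × ℝ → ℝ} (hf : f ∈ e.Pol) {x : ℝ × ℝ}
    (hx : x ∈ e.D) : ContDiffAt ℝ 1 (grad e.F f) x :=
  contDiffAt_grad (n := 1) e.smooth.contDiffAt (e.smooth_pol f hf).contDiffAt (e.invertible x hx)

theorem differentiableAt_grad (e : Elem M p) {f : ℝ × ℝ → ℝ} (hf : f ∈ e.Pol) {x : ℝ × ℝ}
    (hx : x ∈ e.D) : DifferentiableAt ℝ (grad e.F f) x :=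
  (e.contDiffAt_grad_pol hf hx).differentiableAt (by norm_num)

theorem fderiv_side (e : Elem M p) (j : Fin e.n) (t : ℝ) :
    fderiv ℝ e.F (e.side j t) (e.corner (e.en j) - e.corner (e.st j))
      = M.vertex (M.edgeEnd (e.edgeIdx j) 1) - M.vertex (M.edgeEnd (e.edgeIdx j) 0) := by
  have h1 : HasDerivAt (fun t => e.F (e.side j t)) _ t :=
    (e.differentiable (e.side j t)).hasFDerivAt.comp_hasDerivAt t (e.hasDerivAt_side j t)
  have h2 : (fun t => e.F (e.side j t)) = fun t => M.edgePoint (e.edgeIdx j) t :=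
    funext (e.map_side j)
  rw [h2] at h1
  exact h1.unique (hasDerivAt_segment _ _ t)

theorem hasDerivAt_trace (e : Elem M p) {f : ℝ × ℝ → ℝ} (hf : f ∈ e.Pol) (j : Fin e.n) {t : ℝ}
    (ht : t ∈ Icc (0 : ℝ) 1) : HasDerivAt (fun t => f (e.side j t))
      (grad e.F f (e.side j t) (M.vertex (M.edgeEnd (e.edgeIdx j) 1)
        - M.vertex (M.edgeEnd (e.edgeIdx j) 0))) t := by
  rw [← e.fderiv_side j t, grad_apply_fderiv _ (e.invertible _ (e.mem_side j ht))]
  exact (e.differentiable_pol hf _).hasFDerivAt.comp_hasDerivAt t (e.hasDerivAt_side j t)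

theorem hasDerivAt_grad_trace (e : Elem M p) {f : ℝ × ℝ → ℝ} (hf : f ∈ e.Pol) (j : Fin e.n)
    {t : ℝ} (ht : t ∈ Icc (0 : ℝ) 1) : HasDerivAt (fun t => grad e.F f (e.side j t))
      (hess e.F f (e.side j t) (M.vertex (M.edgeEnd (e.edgeIdx j) 1)
        - M.vertex (M.edgeEnd (e.edgeIdx j) 0))) t := by
  have hx := e.mem_side j ht
  rw [← e.fderiv_side j t, hess, grad_apply_fderiv _ (e.invertible _ hx)]
  exact (e.differentiableAt_grad hf hx).hasFDerivAt.comp_hasDerivAt t (e.hasDerivAt_side j t)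

end Elem

/-- Parameters of interpolation points on the edges. -/
structure EdgeParams (ιE : Type*) (p : ℕ) where
  R : ιE → Fin (p - 5) → ℝ
  S : ιE → Fin (p - 4) → ℝ
  R_mem : ∀ k l, R k l ∈ Ioo (0 : ℝ) 1
  S_mem : ∀ k l, S k l ∈ Ioo (0 : ℝ) 1
  R_inj : ∀ k, Function.Injective (R k)
  S_inj : ∀ k, Function.Injective (S k)

namespace Elem

/-- `f` solves the interpolation problem on the element `e`, where `τ` are the values prescribed
at the interior points. -/
structure LocalSol (e : Elem M p) (E : EdgeParams ιE p)
    (s : MeshData.InterpValues ιV ιE ιT ιQ p) (τ : e.κ → ℝ) (f : ℝ × ℝ → ℝ) : Prop where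
  mem : f ∈ e.Pol
  v00 : ∀ j, f (e.corner j) = s.σV (e.vtx j) 0 0
  v10 : ∀ j, grad e.F f (e.corner j) !₂[1, 0] = s.σV (e.vtx j) 1 0
  v01 : ∀ j, grad e.F f (e.corner j) !₂[0, 1] = s.σV (e.vtx j) 0 1
  v20 : ∀ j, hess e.F f (e.corner j) !₂[1, 0] !₂[1, 0] = s.σV (e.vtx j) 2 0
  v11 : ∀ j, hess e.F f (e.corner j) !₂[1, 0] !₂[0, 1] = s.σV (e.vtx j) 1 1
  v02 : ∀ j, hess e.F f (e.corner j) !₂[0, 1] !₂[0, 1] = s.σV (e.vtx j) 0 2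
  edge : ∀ j, ∃ q : Polynomial ℝ, q.natDegree ≤ p - 1 ∧
    ∀ t ∈ Ioo (0 : ℝ) 1, grad e.F f (e.side j t) (M.normal (e.edgeIdx j)) = q.eval t
  valR : ∀ j l, f (e.side j (E.R (e.edgeIdx j) l)) = s.σE (e.edgeIdx j) l
  normalS : ∀ j l, grad e.F f (e.side j (E.S (e.edgeIdx j) l)) (M.normal (e.edgeIdx j))
    = s.wE (e.edgeIdx j) l
  valPt : ∀ l, f (e.pt l) = τ l

theorem clm_ext_basis {G : Type*} [NormedAddCommGroup G] [NormedSpace ℝ G]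
    {A B : Plane →L[ℝ] G} (h1 : A !₂[1, 0] = B !₂[1, 0])
    (h2 : A !₂[0, 1] = B !₂[0, 1]) : A = B := by
  ext w
  have : w = w 0 • (!₂[1, 0] : Plane) + w 1 • (!₂[0, 1] : Plane) := by
    ext i
    fin_cases i <;> simp
  rw [this, map_add, map_add, map_smul, map_smul, map_smul, map_smul, h1, h2]

variable {e e' : Elem M p} {E : EdgeParams ιE p} {s : MeshData.InterpValues ιV ιE ιT ιQ p}
  {τ : e.κ → ℝ} {τ' : e'.κ → ℝ} {f f' : ℝ × ℝ → ℝ}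

/-- Local solutions on two elements have the same 2-jet at a common vertex. -/
theorem LocalSol.jet_vertex (hf : e.LocalSol E s τ f) (hf' : e'.LocalSol E s τ' f')
    {j : Fin e.n} {j' : Fin e'.n} (hv : e.vtx j = e'.vtx j') :
    f (e.corner j) = f' (e'.corner j') ∧
    grad e.F f (e.corner j) = grad e'.F f' (e'.corner j') ∧
    hess e.F f (e.corner j) = hess e'.F f' (e'.corner j') := by
  refine ⟨by rw [hf.v00, hf'.v00, hv], clm_ext_basis ?_ ?_, clm_ext_basis ?_ ?_⟩
  · rw [hf.v10, hf'.v10, hv]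
  · rw [hf.v01, hf'.v01, hv]
  · refine clm_ext_basis ?_ ?_
    · rw [hf.v20, hf'.v20, hv]
    · rw [hf.v11, hf'.v11, hv]
  · refine clm_ext_basis ?_ ?_
    -- Only one of the two mixed derivatives is prescribed.
    · rw [hess_symm e.smooth (e.smooth_pol f hf.mem) (e.invertible _ (e.corner_mem j)),
        hess_symm e'.smooth (e'.smooth_pol f' hf'.mem) (e'.invertible _ (e'.corner_mem j')),
        hf.v11, hf'.v11, hv]
    · rw [hf.v02, hf'.v02, hv]

/-- Local solutions on two elements have the same value and gradient along a common edge. -/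
theorem LocalSol.jet_edge (hp : 5 ≤ p)
    (hnd : ∀ k, M.vertex (M.edgeEnd k 0) ≠ M.vertex (M.edgeEnd k 1))
    (hf : e.LocalSol E s τ f) (hf' : e'.LocalSol E s τ' f')
    {j : Fin e.n} {j' : Fin e'.n} (hk : e.edgeIdx j = e'.edgeIdx j') :
    ∀ t ∈ Icc (0 : ℝ) 1, f (e.side j t) = f' (e'.side j' t) ∧
      grad e.F f (e.side j t) = grad e'.F f' (e'.side j' t) := by
  have m0 : (0 : ℝ) ∈ Icc (0 : ℝ) 1 := by simp
  have m1 : (1 : ℝ) ∈ Icc (0 : ℝ) 1 := by simp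
  obtain ⟨a0, A0, H0⟩ := hf.jet_vertex hf' (j := e.st j) (j' := e'.st j')
    (by rw [e.vtx_st, e'.vtx_st, hk])
  obtain ⟨a1, A1, H1⟩ := hf.jet_vertex hf' (j := e.en j) (j' := e'.en j')
    (by rw [e.vtx_en, e'.vtx_en, hk])
  set d := M.vertex (M.edgeEnd (e.edgeIdx j) 1) - M.vertex (M.edgeEnd (e.edgeIdx j) 0) with hd
  have hd0 : d ≠ 0 := sub_ne_zero.2 (hnd _).symm
  have key := jet_eq_zero_on_edge (d := d) (n := M.normal (e.edgeIdx j)) hp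
    (a := fun t => f (e.side j t) - f' (e'.side j' t))
    (A := fun t => grad e.F f (e.side j t) - grad e'.F f' (e'.side j' t))
    (fun L h1 h2 => clm_ext_plane hd0 (c := ‖d‖⁻¹) (by simpa using hd0) h1 h2)
    ?_ ?_ ?_ ?_ ?_ ?_ ?_ ?_ ?_ (E.R (e.edgeIdx j)) (E.R_inj _) (E.R_mem _) ?_
    (E.S (e.edgeIdx j)) (E.S_inj _) (E.S_mem _) ?_
  · intro t ht
    exact ⟨sub_eq_zero.1 (key t ht).1, sub_eq_zero.1 (key t ht).2⟩
  · obtain ⟨q, hq, h⟩ := e.trace_pol f hf.mem j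
    obtain ⟨q', hq', h'⟩ := e'.trace_pol f' hf'.mem j'
    refine ⟨q - q', (Polynomial.natDegree_sub_le _ _).trans (max_le hq hq'), fun t => ?_⟩
    rw [Polynomial.eval_sub, ← h, ← h']
    rfl
  · intro t ht
    have h' := e'.hasDerivAt_trace hf'.mem j' ht
    rw [← hk] at h'
    exact (e.hasDerivAt_trace hf.mem j ht).sub h'
  · obtain ⟨q, hq, h⟩ := hf.edge j
    obtain ⟨q', hq', h'⟩ := hf'.edge j'
    refine ⟨q - q', (Polynomial.natDegree_sub_le _ _).trans (max_le hq hq'), fun t ht => ?_⟩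
    rw [Polynomial.eval_sub, ← h t ht, ← h' t ht, hk]
    rfl
  · simp only [side_zero, a0, sub_self]
  · simp only [side_zero, A0, sub_self]
  · have h' := e'.hasDerivAt_grad_trace hf'.mem j' m0
    rw [← hk] at h'
    have h := (e.hasDerivAt_grad_trace hf.mem j m0).sub h'
    rw [side_zero, side_zero, H0, sub_self] at h
    exact h
  · simp only [side_one, a1, sub_self]
  · simp only [side_one, A1, sub_self]
  · have h' := e'.hasDerivAt_grad_trace hf'.mem j' m1
    rw [← hk] at h'
    have h := (e.hasDerivAt_grad_trace hf.mem j m1).sub h'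
    rw [side_one, side_one, H1, sub_self] at h
    exact h
  · intro l
    have h' := hf'.valR j' l
    rw [← hk] at h'
    simp only [hf.valR, h', sub_self]
  · intro l
    have h' := hf'.normalS j' l
    rw [← hk] at h'
    simp only [sub_apply, hf.normalS, h', sub_self]

/-- The local interpolation problem has at most one solution. -/
theorem LocalSol.unique (hp : 5 ≤ p)
    (hnd : ∀ k, M.vertex (M.edgeEnd k 0) ≠ M.vertex (M.edgeEnd k 1))
    {f' : ℝ × ℝ → ℝ} (hf : e.LocalSol E s τ f) (hf' : e.LocalSol E s τ f') : f = f' := by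
  rw [← sub_eq_zero]
  refine e.unisolvent_pol _ (e.Pol.sub_mem hf.mem hf'.mem) (fun j t ht => ?_) (fun l => ?_)
  · obtain ⟨h1, h2⟩ := hf.jet_edge hp hnd hf' (j := j) rfl t ht
    refine ⟨sub_eq_zero.2 h1, ContinuousLinearMap.ext fun v => ?_⟩
    have hx := e.invertible _ (e.mem_side j ht)
    have h3 : fderiv ℝ (f - f') (e.side j t) v = 0 := by
      rw [fderiv_sub (e.differentiable_pol hf.mem _) (e.differentiable_pol hf'.mem _), sub_apply,
        ← grad_apply_fderiv f hx, ← grad_apply_fderiv f' hx, h2, sub_self]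
    exact h3
  · simp [hf.valPt, hf'.valPt]

/-- Point evaluation on the polynomial space. -/
def evalLin (e : Elem M p) (x : ℝ × ℝ) : e.Pol →ₗ[ℝ] ℝ :=
  (LinearMap.proj x).comp e.Pol.subtype

/-- A directional derivative in the physical variable as a functional on the polynomial space. -/
def gradLin (e : Elem M p) (x : ℝ × ℝ) (w : Plane) : e.Pol →ₗ[ℝ] ℝ where
  toFun f := grad e.F f.1 x w
  map_add' f g := by
    have := grad_add (F := e.F) (e.differentiable_pol f.2 x) (e.differentiable_pol g.2 x)
    simp [this]
  map_smul' c f := by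
    have := grad_smul (F := e.F) c (e.differentiable_pol f.2 x)
    simp [this]

/-- A second derivative in the physical variable as a functional on the polynomial space. -/
def hessLin (e : Elem M p) {x : ℝ × ℝ} (hx : x ∈ e.D) (w w' : Plane) : e.Pol →ₗ[ℝ] ℝ where
  toFun f := hess e.F f.1 x w w'
  map_add' f g := by
    have := hess_add e.smooth (e.smooth_pol _ f.2) (e.smooth_pol _ g.2) (e.invertible x hx)
    simp [this]
  map_smul' c f := by
    have := hess_smul c e.smooth (e.smooth_pol _ f.2) (e.invertible x hx)
    simp [this]

/-- The local interpolation problem is solvable: by uniqueness, its conditions and the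
functionals `lam` together form an injective linear map between spaces of equal dimension. -/
theorem exists_localSol (e : Elem M p) (hp : 5 ≤ p)
    (hnd : ∀ k, M.vertex (M.edgeEnd k 0) ≠ M.vertex (M.edgeEnd k 1))
    (E : EdgeParams ιE p)
    (s : MeshData.InterpValues ιV ιE ιT ιQ p) (τ : e.κ → ℝ) : ∃ f, e.LocalSol E s τ f := by
  let vfun : Fin e.n × Fin 6 → e.Pol →ₗ[ℝ] ℝ := fun i =>
    ![e.evalLin (e.corner i.1), e.gradLin (e.corner i.1) !₂[1, 0],
      e.gradLin (e.corner i.1) !₂[0, 1], e.hessLin (e.corner_mem i.1) !₂[1, 0] !₂[1, 0],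
      e.hessLin (e.corner_mem i.1) !₂[1, 0] !₂[0, 1],
      e.hessLin (e.corner_mem i.1) !₂[0, 1] !₂[0, 1]] i.2
  let efun : Fin e.n × (Fin (p - 5) ⊕ Fin (p - 4)) → e.Pol →ₗ[ℝ] ℝ := fun i =>
    i.2.elim (fun l => e.evalLin (e.side i.1 (E.R (e.edgeIdx i.1) l)))
      (fun l => e.gradLin (e.side i.1 (E.S (e.edgeIdx i.1) l)) (M.normal (e.edgeIdx i.1)))
  let L : e.Pol →ₗ[ℝ] ((Fin e.n × Fin 6) ⊕ ((Fin e.n × (Fin (p - 5) ⊕ Fin (p - 4)))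
      ⊕ (e.κ ⊕ Fin e.m)) → ℝ) :=
    LinearMap.pi (Sum.elim vfun (Sum.elim efun (Sum.elim (fun l => e.evalLin (e.pt l)) e.lam)))
  have hL : ∀ (s' : MeshData.InterpValues ιV ιE ιT ιQ p) (τ' : e.κ → ℝ) (f : e.Pol),
      L f = Sum.elim (fun i => ![s'.σV (e.vtx i.1) 0 0, s'.σV (e.vtx i.1) 1 0,
          s'.σV (e.vtx i.1) 0 1, s'.σV (e.vtx i.1) 2 0, s'.σV (e.vtx i.1) 1 1,
          s'.σV (e.vtx i.1) 0 2] i.2)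
        (Sum.elim (fun i => i.2.elim (s'.σE (e.edgeIdx i.1)) (s'.wE (e.edgeIdx i.1)))
          (Sum.elim τ' 0)) → e.LocalSol E s' τ' f.1 := by
    intro s' τ' f h
    have hv : ∀ j i, _ := fun j i => congrFun h (Sum.inl (j, i))
    have hE : ∀ j i, _ := fun j i => congrFun h (Sum.inr (Sum.inl (j, i)))
    have hP : ∀ l, _ := fun l => congrFun h (Sum.inr (Sum.inr (Sum.inl l)))
    have hm : ∀ l, _ := fun l => congrFun h (Sum.inr (Sum.inr (Sum.inr l)))
    exact
      { mem := f.2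
        v00 := fun j => hv j 0
        v10 := fun j => hv j 1
        v01 := fun j => hv j 2
        v20 := fun j => hv j 3
        v11 := fun j => hv j 4
        v02 := fun j => hv j 5
        edge := e.normal_pol f hm
        valR := fun j l => hE j (Sum.inl l)
        normalS := fun j l => hE j (Sum.inr l)
        valPt := hP }
  have hinj : Function.Injective L := by
    rw [← LinearMap.ker_eq_bot, LinearMap.ker_eq_bot']
    have aux : ∀ f : e.Pol, L f = 0 → e.LocalSol E ⟨0, 0, 0, 0, 0⟩ 0 f.1 := by
      intro f hf
      refine hL _ _ f (hf.trans ?_)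
      ext i
      rcases i with ⟨j, i⟩ | ⟨j, i | i⟩ | i | i
      · fin_cases i <;> rfl
      all_goals rfl
    intro f hf
    exact Subtype.ext ((aux f hf).unique hp hnd (aux 0 (map_zero L)))
  have hsurj : Function.Surjective L := by
    refine (LinearMap.injective_iff_surjective_of_finrank_eq_finrank ?_).1 hinj
    rw [e.finrank_pol]
    simp
  obtain ⟨f, hf⟩ := hsurj _
  exact ⟨f.1, hL s τ f hf⟩

end Elem

end Elements

/-! ### Gluing along finite unions -/

theorem hasFDerivWithinAt_iUnion {ε G : Type*} [Finite ε] [NormedAddCommGroup G]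
    [NormedSpace ℝ G] {K : ε → Set Plane} (hK : ∀ e, IsClosed (K e)) {φ : Plane → G}
    {L : Plane →L[ℝ] G} {y : Plane} (h : ∀ e, y ∈ K e → HasFDerivWithinAt φ L (K e) y) :
    HasFDerivWithinAt φ L (⋃ e, K e) y := by
  have h' : ∀ e, HasFDerivWithinAt φ L (K e) y := fun e => by
    by_cases hy : y ∈ K e
    · exact h e hy
    · exact .of_notMem_closure (by rwa [(hK e).closure_eq])
  have hfin : ∀ s : Finset ε, HasFDerivWithinAt φ L (⋃ e ∈ s, K e) y := by
    classical
    intro s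
    induction s using Finset.induction_on with
    | empty => simp
    | insert e s _ ih =>
      rw [Finset.set_biUnion_insert]
      exact (h' e).union ih
  have := Fintype.ofFinite ε
  simpa using hfin Finset.univ

theorem exists_glue {ε X Y Z : Type*} [Inhabited Z] {D : ε → Set X} {F : ε → X → Y}
    (g : ε → X → Z)
    (h : ∀ e e' x x', x ∈ D e → x' ∈ D e' → F e x = F e' x' → g e x = g e' x') :
    ∃ φ : Y → Z, ∀ e, ∀ x ∈ D e, φ (F e x) = g e x := by
  classical
  refine ⟨fun y => if hy : ∃ q : ε × X, q.2 ∈ D q.1 ∧ F q.1 q.2 = y then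
    g hy.choose.1 hy.choose.2 else default, fun e x hx => ?_⟩
  have hy : ∃ q : ε × X, q.2 ∈ D q.1 ∧ F q.1 q.2 = F e x := ⟨(e, x), hx, rfl⟩
  simp only [dif_pos hy]
  exact h _ _ _ _ hy.choose_spec.1 hx hy.choose_spec.2

/-! ### Second-order partial derivatives at a point -/

theorem fderivWithin_dirDeriv {K : Set Plane} {φ : Plane → ℝ} {V : Plane}
    (hu : UniqueDiffWithinAt ℝ K V) (h : DifferentiableWithinAt ℝ (fderivWithin ℝ φ K) K V)
    (v w : Plane) : dirDeriv K v (dirDeriv K w φ) V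
      = fderivWithin ℝ (fderivWithin ℝ φ K) K V v w := by
  have h1 := h.hasFDerivWithinAt.clm_apply (hasFDerivWithinAt_const w V K)
  have h2 : fderivWithin ℝ (dirDeriv K w φ) K V = _ := h1.fderivWithin hu
  rw [dirDeriv, h2]
  simp

/-! ### The geometry of a mesh -/

section Mesh

variable {ιV ιE ιT ιQ : Type*} {M : MeshData ιV ιE ιT ιQ} {Ω : Set Plane} {p : ℕ}

theorem MeshData.edgePoint_mem (M : MeshData ιV ιE ιT ιQ) (k : ιE) {t : ℝ}
    (ht : t ∈ Ioo (0 : ℝ) 1) : M.edgePoint k t ∈ M.edge k :=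
  ⟨1 - t, t, sub_pos.2 ht.2, ht.1, by ring, rfl⟩

theorem MeshData.exists_edgePoint (M : MeshData ιV ιE ιT ιQ) {k : ιE} {y : Plane}
    (hy : y ∈ M.edge k) : ∃ t ∈ Ioo (0 : ℝ) 1, M.edgePoint k t = y := by
  obtain ⟨a, b, ha, hb, hab, rfl⟩ := hy
  obtain rfl : a = 1 - b := by linarith
  exact ⟨b, ⟨hb, by linarith⟩, rfl⟩

namespace MeshData.IsMixedMesh

theorem cell_unique (hM : M.IsMixedMesh Ω) {c c' : (ιT ⊕ ιQ) ⊕ (ιE ⊕ ιV)} {y : Plane}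
    (h : y ∈ M.cell c) (h' : y ∈ M.cell c') : c = c' := by
  by_contra hne
  exact (Set.disjoint_left.1 (hM.disjoint hne)) h h'

theorem cell_subset (hM : M.IsMixedMesh Ω) (c : (ιT ⊕ ιQ) ⊕ (ιE ⊕ ιV)) :
    M.cell c ⊆ closure Ω := by
  rw [hM.cover]
  exact subset_iUnion _ c

theorem vertex_injective (hM : M.IsMixedMesh Ω) : Function.Injective M.vertex := by
  intro i j hij
  have := hM.cell_unique (c := Sum.inr (Sum.inr i)) (c' := Sum.inr (Sum.inr j))
    (y := M.vertex i) rfl hij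
  simpa using this

/-- An edge is not degenerate, as it would otherwise contain a vertex. -/
theorem edge_ne (hM : M.IsMixedMesh Ω) (k : ιE) :
    M.vertex (M.edgeEnd k 0) ≠ M.vertex (M.edgeEnd k 1) := by
  intro h
  have hmem : M.vertex (M.edgeEnd k 0) ∈ M.edge k := by
    rw [MeshData.edge, ← h, openSegment_same]
    rfl
  have := hM.cell_unique (c := Sum.inr (Sum.inl k)) (c' := Sum.inr (Sum.inr (M.edgeEnd k 0)))
    hmem rfl
  simp at this

/-- If an edge of the mesh coincides with the segment between two vertices, then these vertices
are its end points: no other vertex lies in the closure of the edge. -/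
theorem edgeEnd_eq (hM : M.IsMixedMesh Ω) {k : ιE} {i j : ιV}
    (h : M.edge k = openSegment ℝ (M.vertex i) (M.vertex j)) :
    (i = M.edgeEnd k 0 ∧ j = M.edgeEnd k 1) ∨ (i = M.edgeEnd k 1 ∧ j = M.edgeEnd k 0) := by
  have hcl : segment ℝ (M.vertex (M.edgeEnd k 0)) (M.vertex (M.edgeEnd k 1))
      = segment ℝ (M.vertex i) (M.vertex j) := by
    rw [← closure_openSegment, ← closure_openSegment, ← h]
    rfl
  have hnot : ∀ l, M.vertex l ∉ M.edge k := fun l hl => by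
    have := hM.cell_unique (c := Sum.inr (Sum.inl k)) (c' := Sum.inr (Sum.inr l)) hl rfl
    simp at this
  have aux : ∀ (a b : ιV), M.edge k = openSegment ℝ (M.vertex a) (M.vertex b) →
      ∀ l, M.vertex l ∈ segment ℝ (M.vertex a) (M.vertex b) → l = a ∨ l = b := by
    intro a b hab l hl
    rw [← insert_endpoints_openSegment, ← hab] at hl
    rcases hl with hl | hl | hl
    · exact Or.inl (hM.vertex_injective hl)
    · exact Or.inr (hM.vertex_injective hl)
    · exact absurd hl (hnot l)
  have h0 := aux i j h _ (hcl ▸ left_mem_segment ℝ _ _)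
  have h1 := aux i j h _ (hcl ▸ right_mem_segment ℝ _ _)
  have hne : M.edgeEnd k 0 ≠ M.edgeEnd k 1 := fun e => hM.edge_ne k (congrArg M.vertex e)
  grind

end MeshData.IsMixedMesh

theorem volume_openSegment (a b : Plane) : MeasureTheory.volume (openSegment ℝ a b) = 0 := by
  refine MeasureTheory.measure_mono_null (t := (affineSpan ℝ {a, b} : AffineSubspace ℝ Plane))
    ?_ ?_
  · refine (openSegment_subset_segment ℝ a b).trans ?_
    rw [← convexHull_pair]
    exact convexHull_subset_affineSpan _
  · refine MeasureTheory.Measure.addHaar_affineSubspace _ _ fun h => ?_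
    have h1 : Module.finrank ℝ (vectorSpan ℝ {a, b}) ≤ 1 :=
      collinear_iff_finrank_le_one.1 (collinear_pair ℝ a b)
    rw [← direction_affineSpan, h, AffineSubspace.direction_top, finrank_top] at h1
    simp at h1

variable {el : ιT ⊕ ιQ → Elem M p}

/-- The elements of the family `el` parametrize the elements of the mesh. -/
def Parametrizes (M : MeshData ιV ιE ιT ιQ) (el : ιT ⊕ ιQ → Elem M p) : Prop :=
  ∀ e, (el e).F '' interior (el e).D = M.cell (Sum.inl e)

theorem exists_cell (hel : Parametrizes M el) (e : ιT ⊕ ιQ) {x : ℝ × ℝ} (hx : x ∈ (el e).D) :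
    (x ∈ interior (el e).D ∧ (el e).F x ∈ M.cell (Sum.inl e)) ∨
    (∃ j, ∃ t ∈ Ioo (0 : ℝ) 1, x = (el e).side j t ∧
      (el e).F x ∈ M.cell (Sum.inr (Sum.inl ((el e).edgeIdx j)))) ∨
    (∃ j, x = (el e).corner j ∧ (el e).F x ∈ M.cell (Sum.inr (Sum.inr ((el e).vtx j)))) := by
  rcases (el e).decomp x hx with h | ⟨j, t, ht, rfl⟩ | ⟨j, rfl⟩
  · refine Or.inl ⟨h, ?_⟩
    rw [← hel e]
    exact ⟨x, h, rfl⟩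
  · refine Or.inr (Or.inl ⟨j, t, ht, rfl, ?_⟩)
    rw [(el e).map_side]
    exact M.edgePoint_mem _ ht
  · refine Or.inr (Or.inr ⟨j, rfl, ?_⟩)
    rw [(el e).map_corner]
    rfl

theorem isClosed_elem (e : Elem M p) : IsClosed (e.F '' e.D) :=
  (e.compact.image e.differentiable.continuous).isClosed

variable [Finite ιV] [Finite ιE] [Finite ιT] [Finite ιQ]

/-- The closed elements cover the closure of the domain: the edges and vertices outside their
union would form a null set containing a non-empty open set. -/
theorem closure_eq_iUnion (hM : M.IsMixedMesh Ω) (hel : Parametrizes M el) :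
    closure Ω = ⋃ e, (el e).F '' (el e).D := by
  have hclosed : IsClosed (⋃ e, (el e).F '' (el e).D) :=
    isClosed_iUnion_of_finite fun e => isClosed_elem (el e)
  apply Subset.antisymm
  · refine closure_minimal ?_ hclosed
    by_contra hne
    have hU : IsOpen (Ω \ ⋃ e, (el e).F '' (el e).D) := hM.isOpen.sdiff hclosed
    have hpos := hU.measure_pos MeasureTheory.volume (Set.sdiff_nonempty.2 hne)
    refine hpos.ne' (MeasureTheory.measure_mono_null
      (t := (⋃ k, M.edge k) ∪ ⋃ i, {M.vertex i}) ?_ ?_)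
    · rintro y ⟨hy, hyn⟩
      have hy' := subset_closure hy
      rw [hM.cover] at hy'
      obtain ⟨c, hc⟩ := mem_iUnion.1 hy'
      rcases c with e | k | i
      · rw [← hel e] at hc
        exact absurd (mem_iUnion.2 ⟨e, image_mono interior_subset hc⟩) hyn
      · exact Or.inl (mem_iUnion.2 ⟨k, hc⟩)
      · exact Or.inr (mem_iUnion.2 ⟨i, hc⟩)
    · have := Finite.to_countable (α := ιE)
      have := Finite.to_countable (α := ιV)
      refine MeasureTheory.measure_union_null ?_ ?_
      · exact MeasureTheory.measure_iUnion_null fun k => volume_openSegment _ _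
      · exact MeasureTheory.measure_iUnion_null fun i => MeasureTheory.measure_singleton _
  · refine iUnion_subset fun e => ?_
    rintro _ ⟨x, hx, rfl⟩
    rcases exists_cell hel e hx with h | ⟨j, t, _, _, h⟩ | ⟨j, _, h⟩
    · exact hM.cell_subset _ h.2
    · exact hM.cell_subset _ h
    · exact hM.cell_subset _ h

theorem exists_corner (hM : M.IsMixedMesh Ω) (hel : Parametrizes M el) (i : ιV) :
    ∃ e, ∃ j, (el e).vtx j = i := by
  have h : M.vertex i ∈ closure Ω := hM.cell_subset (Sum.inr (Sum.inr i)) rfl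
  rw [closure_eq_iUnion hM hel] at h
  obtain ⟨e, x, hx, hxi⟩ := mem_iUnion.1 h
  have hc : (el e).F x ∈ M.cell (Sum.inr (Sum.inr i)) := hxi
  rcases exists_cell hel e hx with h | ⟨j, t, _, _, h⟩ | ⟨j, _, h⟩
  · simpa using hM.cell_unique h.2 hc
  · simpa using hM.cell_unique h hc
  · exact ⟨e, j, by simpa using hM.cell_unique h hc⟩

theorem exists_side (hM : M.IsMixedMesh Ω) (hel : Parametrizes M el) (k : ιE) :
    ∃ e, ∃ j, (el e).edgeIdx j = k := by
  have hm := M.edgePoint_mem k (t := 1 / 2) (by norm_num)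
  have h : M.edgePoint k (1 / 2) ∈ closure Ω := hM.cell_subset (Sum.inr (Sum.inl k)) hm
  rw [closure_eq_iUnion hM hel] at h
  obtain ⟨e, x, hx, hxi⟩ := mem_iUnion.1 h
  have hc : (el e).F x ∈ M.cell (Sum.inr (Sum.inl k)) := hxi ▸ hm
  rcases exists_cell hel e hx with h | ⟨j, t, _, _, h⟩ | ⟨j, _, h⟩
  · simpa using hM.cell_unique h.2 hc
  · exact ⟨e, j, by simpa using hM.cell_unique h hc⟩
  · simpa using hM.cell_unique h hc

theorem uniqueDiffOn_closure (hM : M.IsMixedMesh Ω) (hel : Parametrizes M el) :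
    UniqueDiffOn ℝ (closure Ω) := by
  rw [closure_eq_iUnion hM hel]
  intro y hy
  obtain ⟨e, x, hx, rfl⟩ := mem_iUnion.1 hy
  refine UniqueDiffWithinAt.mono (s := (el e).F '' (el e).D) ?_ (subset_iUnion_of_subset e
    Subset.rfl)
  have hd := ((el e).differentiable x).hasFDerivAt.hasFDerivWithinAt (s := (el e).D)
  refine hd.uniqueDiffWithinAt ((el e).uniqueDiff x hx) ?_
  exact Function.Surjective.denseRange fun w =>
    ⟨_, fderiv_apply_inverse ((el e).invertible x hx) w⟩

/-! ### From functions on the domain to local solutions -/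

theorem mapsTo_closure (hM : M.IsMixedMesh Ω) (hel : Parametrizes M el) (e : ιT ⊕ ιQ) :
    MapsTo (el e).F (el e).D (closure Ω) := by
  rw [closure_eq_iUnion hM hel]
  exact fun x hx => mem_iUnion.2 ⟨e, x, hx, rfl⟩

theorem fderivWithin_eq_grad_of_eqOn (hM : M.IsMixedMesh Ω) (hel : Parametrizes M el)
    {ψ : Plane → ℝ} (hψ : DifferentiableOn ℝ ψ (closure Ω)) {e : ιT ⊕ ιQ} {f : ℝ × ℝ → ℝ}
    (hf : f ∈ (el e).Pol) (h : ∀ x ∈ (el e).D, ψ ((el e).F x) = f x) :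
    ∀ x ∈ (el e).D, fderivWithin ℝ ψ (closure Ω) ((el e).F x) = grad (el e).F f x := by
  intro x hx
  exact fderivWithin_eq_grad ((el e).differentiable x) ((el e).differentiable_pol hf x)
    ((el e).invertible x hx) ((el e).uniqueDiff x hx) hx (mapsTo_closure hM hel e)
    (hψ _ (mapsTo_closure hM hel e hx)) h

theorem fderivWithin_fderivWithin_eq_hess (hM : M.IsMixedMesh Ω) (hel : Parametrizes M el)
    {ψ : Plane → ℝ} (hψ : DifferentiableOn ℝ ψ (closure Ω)) {e : ιT ⊕ ιQ} {f : ℝ × ℝ → ℝ}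
    (hf : f ∈ (el e).Pol) (h : ∀ x ∈ (el e).D, ψ ((el e).F x) = f x) {x : ℝ × ℝ}
    (hx : x ∈ (el e).D) (h2 : DifferentiableWithinAt ℝ (fderivWithin ℝ ψ (closure Ω))
      (closure Ω) ((el e).F x)) :
    fderivWithin ℝ (fderivWithin ℝ ψ (closure Ω)) (closure Ω) ((el e).F x)
      = hess (el e).F f x :=
  fderivWithin_eq_grad ((el e).differentiable x) ((el e).differentiableAt_grad hf hx)
    ((el e).invertible x hx) ((el e).uniqueDiff x hx) hx (mapsTo_closure hM hel e) h2
    (fderivWithin_eq_grad_of_eqOn hM hel hψ hf h)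

end Mesh

/-! ### The global interpolation problem -/

section Global

variable {ιV ιE ιT ιQ : Type*} {M : MeshData ιV ιE ιT ιQ} {Ω : Set Plane} {p : ℕ}

/-- The interpolation points on the edges come from pairwise different parameters in `(0, 1)`. -/
theorem exists_edgeParams (P : M.InterpPoints p) : ∃ E : EdgeParams ιE p,
    (∀ k l, M.edgePoint k (E.R k l) = P.R k l) ∧ ∀ k l, M.edgePoint k (E.S k l) = P.S k l := by
  choose R hR hR' using fun k l => M.exists_edgePoint (P.R_mem k l)
  choose S hS hS' using fun k l => M.exists_edgePoint (P.S_mem k l)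
  refine ⟨⟨R, S, hR, hS, fun k l l' h => P.R_inj k ?_, fun k l l' h => P.S_inj k ?_⟩, hR', hS'⟩
  · rw [← hR', ← hR', h]
  · rw [← hS', ← hS', h]

variable {el : ιT ⊕ ιQ → Elem M p}
  {E : EdgeParams ιE p} {s : MeshData.InterpValues ιV ιE ιT ιQ p} {τ : ∀ e, (el e).κ → ℝ}

/-- Local solutions agree to first order where their elements meet, and to second order at
vertices. -/
theorem localSol_match (hM : M.IsMixedMesh Ω) (hel : Parametrizes M el) (hp : 5 ≤ p)
    {f : ιT ⊕ ιQ → ℝ × ℝ → ℝ} (hf : ∀ e, (el e).LocalSol E s (τ e) (f e)) {e e' : ιT ⊕ ιQ}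
    {x x' : ℝ × ℝ} (hx : x ∈ (el e).D) (hx' : x' ∈ (el e').D)
    (hxx : (el e).F x = (el e').F x') :
    f e x = f e' x' ∧ grad (el e).F (f e) x = grad (el e').F (f e') x' ∧
    ((x ∈ interior (el e).D ∨ ∃ j, x = (el e).corner j) →
      hess (el e).F (f e) x = hess (el e').F (f e') x') := by
  rcases exists_cell hel e' hx' with ⟨h1', h'⟩ | ⟨j', t', ht', rfl, h'⟩ | ⟨j', rfl, h'⟩ <;>
  rcases exists_cell hel e hx with ⟨h1, h⟩ | ⟨j, t, ht, rfl, h⟩ | ⟨j, rfl, h⟩ <;>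
  have hc := hM.cell_unique h (hxx ▸ h')
  · obtain rfl : e = e' := by simpa using hc
    obtain rfl := (el e).inj hx hx' hxx
    exact ⟨rfl, rfl, fun _ => rfl⟩
  · simp at hc
  · simp at hc
  · simp at hc
  · have hk : (el e).edgeIdx j = (el e').edgeIdx j' := by simpa using hc
    have htt : t = t' := by
      have h1 : M.edgePoint _ t = M.edgePoint _ t' :=
        ((el e).map_side j t).symm.trans (hxx.trans ((el e').map_side j' t'))
      rw [hk] at h1
      have h2 : (t - t') • (M.vertex (M.edgeEnd ((el e').edgeIdx j') 1)
          - M.vertex (M.edgeEnd ((el e').edgeIdx j') 0)) = 0 := by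
        rw [← sub_eq_zero] at h1
        rw [← h1, MeshData.edgePoint, MeshData.edgePoint]
        module
      exact sub_eq_zero.1 ((smul_eq_zero.1 h2).resolve_right
        (sub_ne_zero.2 (hM.edge_ne _).symm))
    subst htt
    obtain ⟨h1, h2⟩ := (hf e).jet_edge hp hM.edge_ne (hf e') hk t (Ioo_subset_Icc_self ht)
    refine ⟨h1, h2, ?_⟩
    rintro (hint | ⟨i, hi⟩)
    · have h3 : (el e).F ((el e).side j t) ∈ M.cell (Sum.inl e) := by
        rw [← hel e]
        exact ⟨_, hint, rfl⟩
      simpa using hM.cell_unique h h3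
    · have h3 : (el e).F ((el e).side j t) ∈ M.cell (Sum.inr (Sum.inr ((el e).vtx i))) := by
        rw [hi, (el e).map_corner]
        rfl
      simpa using hM.cell_unique h h3
  · simp at hc
  · simp at hc
  · simp at hc
  · have hv : (el e).vtx j = (el e').vtx j' := by simpa using hc
    obtain ⟨h1, h2, h3⟩ := (hf e).jet_vertex (hf e') hv
    exact ⟨h1, h2, fun _ => h3⟩

variable [Finite ιV] [Finite ιE] [Finite ιT] [Finite ιQ]

/-- The pull-back of a solution of the interpolation problem to an element is a local solution. -/
theorem localSol_of_interpolates (hM : M.IsMixedMesh Ω) (hel : Parametrizes M el)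
    {P : M.InterpPoints p} (hR : ∀ k l, M.edgePoint k (E.R k l) = P.R k l)
    (hS : ∀ k l, M.edgePoint k (E.S k l) = P.S k l) {ψ : Plane → ℝ}
    (hψ : M.MemArgyris Ω p ψ) (hI : M.Interpolates Ω P s ψ) {e : ιT ⊕ ιQ} {f : ℝ × ℝ → ℝ}
    (hf : f ∈ (el e).Pol) (h : ∀ x ∈ (el e).D, ψ ((el e).F x) = f x)
    (hτ : ∀ l, ψ ((el e).F ((el e).pt l)) = τ e l) : (el e).LocalSol E s (τ e) f := by
  have hd : DifferentiableOn ℝ ψ (closure Ω) := hψ.c1.differentiableOn (by norm_num)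
  have hu := uniqueDiffOn_closure hM hel
  have hmaps := mapsTo_closure hM hel e
  have hg := fderivWithin_eq_grad_of_eqOn hM hel hd hf h
  have hC2 : ∀ j, DifferentiableWithinAt ℝ (fderivWithin ℝ ψ (closure Ω)) (closure Ω)
      ((el e).F ((el e).corner j)) := fun j => by
    rw [(el e).map_corner]
    exact (hψ.c2 _).1
  have hh : ∀ j v w, dirDeriv (closure Ω) v (dirDeriv (closure Ω) w ψ)
      (M.vertex ((el e).vtx j)) = hess (el e).F f ((el e).corner j) v w := fun j v w => by
    rw [← (el e).map_corner, fderivWithin_dirDeriv (hu _ (hmaps ((el e).corner_mem j))) (hC2 j),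
      fderivWithin_fderivWithin_eq_hess hM hel hd hf h ((el e).corner_mem j) (hC2 j)]
  have hgv : ∀ j w, grad (el e).F f ((el e).corner j) w
      = dirDeriv (closure Ω) w ψ (M.vertex ((el e).vtx j)) := fun j w => by
    rw [← (el e).map_corner, ← hg _ ((el e).corner_mem j)]
    rfl
  have hgs : ∀ j t w, t ∈ Ioo (0 : ℝ) 1 → grad (el e).F f ((el e).side j t) w
      = dirDeriv (closure Ω) w ψ (M.edgePoint ((el e).edgeIdx j) t) := fun j t w ht => by
    rw [← (el e).map_side, ← hg _ ((el e).mem_side j (Ioo_subset_Icc_self ht))]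
    rfl
  exact
    { mem := hf
      v00 := fun j => by
        rw [← h _ ((el e).corner_mem j), (el e).map_corner]
        exact hI.vertices _ 0 0 (by norm_num)
      v10 := fun j => (hgv j _).trans (hI.vertices _ 1 0 (by norm_num))
      v01 := fun j => (hgv j _).trans (hI.vertices _ 0 1 (by norm_num))
      v20 := fun j => (hh j _ _).symm.trans (hI.vertices _ 2 0 (by norm_num))
      v11 := fun j => (hh j _ _).symm.trans (hI.vertices _ 1 1 (by norm_num))
      v02 := fun j => (hh j _ _).symm.trans (hI.vertices _ 0 2 (by norm_num))
      edge := fun j => by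
        obtain ⟨q, hq, hqe⟩ := hψ.edge ((el e).edgeIdx j)
        exact ⟨q, hq, fun t ht => (hgs j t _ ht).trans (hqe t ht)⟩
      valR := fun j l => by
        have hm := (el e).mem_side j (Ioo_subset_Icc_self (E.R_mem ((el e).edgeIdx j) l))
        rw [← h _ hm, ← hI.edge_values, ← hR]
        exact congrArg ψ ((el e).map_side j _)
      normalS := fun j l => by
        rw [hgs j _ _ (E.S_mem _ l), hS, hI.edge_normals]
      valPt := fun l => by rw [← h _ ((el e).pt_mem l), hτ] }

/-- Local solutions glue to a function on the closure of the domain that is continuously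
differentiable, and `C²` at the vertices. Second derivatives of the pieces only have to match in
the open elements, where there is a single piece, and at the vertices. -/
theorem exists_glued (hM : M.IsMixedMesh Ω) (hel : Parametrizes M el) (hp : 5 ≤ p)
    {f : ιT ⊕ ιQ → ℝ × ℝ → ℝ} (hf : ∀ e, (el e).LocalSol E s (τ e) (f e)) :
    ∃ φ : Plane → ℝ, ContDiffOn ℝ 1 φ (closure Ω) ∧ (∀ i, M.IsC2At (closure Ω) φ (M.vertex i)) ∧
      ∀ e, ∀ x ∈ (el e).D, φ ((el e).F x) = f e x := by
  have hK := closure_eq_iUnion hM hel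
  have hu := uniqueDiffOn_closure hM hel
  have hclosed : ∀ e, IsClosed ((el e).F '' (el e).D) := fun e => isClosed_elem (el e)
  obtain ⟨φ, hφ⟩ := exists_glue (D := fun e => (el e).D) (F := fun e => (el e).F) f
    fun e e' x x' hx hx' h => (localSol_match hM hel hp hf hx hx' h).1
  have hd : ∀ e, ∀ x ∈ (el e).D,
      HasFDerivWithinAt φ (grad (el e).F (f e) x) (closure Ω) ((el e).F x) := by
    intro e x hx
    rw [hK]
    refine hasFDerivWithinAt_iUnion hclosed ?_
    rintro e' ⟨x', hx', hxx⟩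
    rw [(localSol_match hM hel hp hf hx hx' hxx.symm).2.1, ← hxx]
    exact hasFDerivWithinAt_of_comp (el e').differentiable (el e').compact (el e').inj hx'
      ((el e').differentiable_pol (hf e').mem x') ((el e').invertible x' hx') (hφ e')
  have hdiff : DifferentiableOn ℝ φ (closure Ω) := by
    intro y hy
    have hy' := hy
    rw [hK] at hy'
    obtain ⟨e, x, hx, rfl⟩ := mem_iUnion.1 hy'
    exact (hd e x hx).differentiableWithinAt
  have hfd := fun e => fderivWithin_eq_grad_of_eqOn hM hel hdiff (hf e).mem (hφ e)
  have hd2 : ∀ e, ∀ x ∈ (el e).D, (x ∈ interior (el e).D ∨ ∃ j, x = (el e).corner j) →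
      HasFDerivWithinAt (fderivWithin ℝ φ (closure Ω)) (hess (el e).F (f e) x) (closure Ω)
        ((el e).F x) := by
    intro e x hx hxc
    suffices H : HasFDerivWithinAt (fderivWithin ℝ φ (closure Ω)) (hess (el e).F (f e) x)
        (⋃ e, (el e).F '' (el e).D) ((el e).F x) by rwa [← hK] at H
    refine hasFDerivWithinAt_iUnion hclosed ?_
    rintro e' ⟨x', hx', hxx⟩
    rw [(localSol_match hM hel hp hf hx hx' hxx.symm).2.2 hxc, ← hxx]
    exact hasFDerivWithinAt_of_comp (el e').differentiable (el e').compact (el e').inj hx'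
      ((el e').differentiableAt_grad (hf e').mem hx') ((el e').invertible x' hx') (hfd e')
  refine ⟨φ, ?_, fun i => ⟨?_, ?_⟩, hφ⟩
  · rw [show (1 : WithTop ℕ∞) = 0 + 1 from rfl, contDiffOn_succ_iff_fderivWithin hu]
    refine ⟨hdiff, by simp, contDiffOn_zero.2 ?_⟩
    suffices H : ContinuousOn (fderivWithin ℝ φ (closure Ω)) (⋃ e, (el e).F '' (el e).D) by
      rwa [← hK] at H
    refine (locallyFinite_of_finite _).continuousOn_iUnion hclosed fun e => ?_
    refine continuousOn_of_comp (el e).differentiable.continuous.continuousOn (el e).compact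
      (el e).inj (fun x hx => ?_) (hfd e)
    exact ((el e).differentiableAt_grad (hf e).mem hx).continuousAt.continuousWithinAt
  · obtain ⟨e, j, rfl⟩ := exists_corner hM hel i
    rw [← (el e).map_corner]
    exact (hd2 e _ ((el e).corner_mem j) (Or.inr ⟨j, rfl⟩)).differentiableWithinAt
  · have hEl : M.elements = ⋃ e, M.cell (Sum.inl e) := by
      ext y
      simp [MeshData.elements, MeshData.cell]
    rw [hEl, ContinuousWithinAt, nhdsWithin_iUnion, tendsto_iSup]
    intro e
    by_cases hmem : M.vertex i ∈ (el e).F '' (el e).D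
    · have hsub : M.cell (Sum.inl e) ⊆ (el e).F '' (el e).D := by
        rw [← hel e]
        exact image_mono interior_subset
      have hx2 : ∀ x ∈ (el e).D, (x ∈ interior (el e).D ∨ ∃ j, x = (el e).corner j) →
          fderivWithin ℝ (fderivWithin ℝ φ (closure Ω)) (closure Ω) ((el e).F x)
            = hess (el e).F (f e) x := fun x hx hxc =>
        (hd2 e x hx hxc).fderivWithin (hu _ (mapsTo_closure hM hel e hx))
      have hcont : ContinuousOn (fun y => hess (el e).F (f e)
          (Function.invFunOn (el e).F (el e).D y)) ((el e).F '' (el e).D) := by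
        refine continuousOn_of_comp (f := hess (el e).F (f e))
          (el e).differentiable.continuous.continuousOn
          (el e).compact (el e).inj (fun x hx => ?_) fun x hx => ?_
        · exact (contDiffAt_grad (n := 0) ((el e).smooth.contDiffAt.of_le (by norm_num))
            ((el e).contDiffAt_grad_pol (hf e).mem hx)
            ((el e).invertible x hx)).continuousAt.continuousWithinAt
        · rw [(el e).inj.leftInvOn_invFunOn hx]
      have hval : ∀ x ∈ (el e).D, (x ∈ interior (el e).D ∨ ∃ j, x = (el e).corner j) →
          fderivWithin ℝ (fderivWithin ℝ φ (closure Ω)) (closure Ω) ((el e).F x)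
            = hess (el e).F (f e) (Function.invFunOn (el e).F (el e).D ((el e).F x)) := by
        intro x hx hxc
        rw [hx2 x hx hxc, (el e).inj.leftInvOn_invFunOn hx]
      refine ((hcont _ hmem).mono hsub).congr (fun y hy => ?_) ?_
      · rw [← hel e] at hy
        obtain ⟨x, hx, rfl⟩ := hy
        exact hval x (interior_subset hx) (Or.inl hx)
      · obtain ⟨x, hx, hxi⟩ := hmem
        rw [← hxi]
        refine hval x hx (Or.inr ?_)
        have hv : (el e).F x ∈ M.cell (Sum.inr (Sum.inr i)) := hxi
        rcases exists_cell hel e hx with h | ⟨j, t, _, _, h⟩ | ⟨j, hj, _⟩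
        · simpa using hM.cell_unique h.2 hv
        · simpa using hM.cell_unique h hv
        · exact ⟨j, hj⟩
    · have hbot : 𝓝[M.cell (Sum.inl e)] (M.vertex i) = ⊥ := by
        rw [← notMem_closure_iff_nhdsWithin_eq_bot]
        intro hcl
        apply hmem
        rw [← (hclosed e).closure_eq]
        refine closure_mono ?_ hcl
        rw [← hel e]
        exact image_mono interior_subset
      rw [hbot]
      exact tendsto_bot

/-- The interpolation problem is uniquely solvable once all elements of the mesh have been given
the structure `Elem`. -/
theorem existsUnique_of_elems (hM : M.IsMixedMesh Ω) (hel : Parametrizes M el) (hp : 5 ≤ p)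
    (P : M.InterpPoints p) (s : MeshData.InterpValues ιV ιE ιT ιQ p) (τ : ∀ e, (el e).κ → ℝ)
    (hpol : ∀ φ : Plane → ℝ, ((∀ i, IsPolyTotal p refTriangle (φ ∘ M.triMap i)) ∧
      ∀ i, IsPolyBi p refSquare (φ ∘ M.quaMap i)) ↔
      ∀ e, ∃ f ∈ (el e).Pol, ∀ x ∈ (el e).D, φ ((el e).F x) = f x)
    (hpt : ∀ φ : Plane → ℝ, ((∀ i l, φ (M.quaMap i (P.Q i l)) = s.σQ i l) ∧
      ∀ i l, φ (M.triMap i (P.T i l)) = s.σT i l) ↔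
      ∀ e l, φ ((el e).F ((el e).pt l)) = τ e l) :
    ∃ φ : Plane → ℝ, (M.MemArgyris Ω p φ ∧ M.Interpolates Ω P s φ) ∧
      ∀ ψ : Plane → ℝ, M.MemArgyris Ω p ψ → M.Interpolates Ω P s ψ →
        Set.EqOn ψ φ (closure Ω) := by
  obtain ⟨E, hR, hS⟩ := exists_edgeParams P
  choose f hf using fun e => (el e).exists_localSol hp hM.edge_ne E s (τ e)
  obtain ⟨φ, hc1, hc2, hφ⟩ := exists_glued hM hel hp hf
  have hd : DifferentiableOn ℝ φ (closure Ω) := hc1.differentiableOn (by norm_num)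
  have hu := uniqueDiffOn_closure hM hel
  have hg := fun e => fderivWithin_eq_grad_of_eqOn hM hel hd (hf e).mem (hφ e)
  have hgs : ∀ e j t w, t ∈ Ioo (0 : ℝ) 1 →
      dirDeriv (closure Ω) w φ (M.edgePoint ((el e).edgeIdx j) t)
        = grad (el e).F (f e) ((el e).side j t) w := fun e j t w ht => by
    rw [← (el e).map_side, ← (hg e) _ ((el e).mem_side j (Ioo_subset_Icc_self ht))]
    rfl
  obtain ⟨htri, hquad⟩ := (hpol φ).2 fun e => ⟨f e, (hf e).mem, hφ e⟩
  obtain ⟨hptQ, hptT⟩ := (hpt φ).2 fun e l => by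
    rw [hφ e _ ((el e).pt_mem l), (hf e).valPt]
  refine ⟨φ, ⟨⟨hc1, htri, hquad, hc2, fun k => ?_⟩, ?_, ?_, ?_, hptQ, hptT⟩, ?_⟩
  · obtain ⟨e, j, rfl⟩ := exists_side hM hel k
    obtain ⟨q, hq, hqe⟩ := (hf e).edge j
    exact ⟨q, hq, fun t ht => (hgs e j t _ ht).trans (hqe t ht)⟩
  · intro i a b hab
    obtain ⟨e, j, rfl⟩ := exists_corner hM hel i
    have h1 : ∀ w, dirDeriv (closure Ω) w φ (M.vertex ((el e).vtx j))
        = grad (el e).F (f e) ((el e).corner j) w := fun w => by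
      rw [← (el e).map_corner, ← (hg e) _ ((el e).corner_mem j)]
      rfl
    have h2 : ∀ v w, dirDeriv (closure Ω) v (dirDeriv (closure Ω) w φ)
        (M.vertex ((el e).vtx j)) = hess (el e).F (f e) ((el e).corner j) v w := fun v w => by
      have hC2 := (hc2 ((el e).vtx j)).1
      rw [fderivWithin_dirDeriv (hu _ (hM.cell_subset (Sum.inr (Sum.inr _)) rfl)) hC2]
      rw [← (el e).map_corner] at hC2 ⊢
      rw [fderivWithin_fderivWithin_eq_hess hM hel hd (hf e).mem (hφ e) ((el e).corner_mem j) hC2]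
    have hcase : (a = 0 ∧ b = 0) ∨ (a = 1 ∧ b = 0) ∨ (a = 0 ∧ b = 1) ∨ (a = 2 ∧ b = 0) ∨
        (a = 1 ∧ b = 1) ∨ (a = 0 ∧ b = 2) := by omega
    rcases hcase with ⟨rfl, rfl⟩ | ⟨rfl, rfl⟩ | ⟨rfl, rfl⟩ | ⟨rfl, rfl⟩ | ⟨rfl, rfl⟩ | ⟨rfl, rfl⟩
    · rw [← (hf e).v00, ← hφ e _ ((el e).corner_mem j), (el e).map_corner]
      rfl
    · exact (h1 _).trans ((hf e).v10 j)
    · exact (h1 _).trans ((hf e).v01 j)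
    · exact (h2 _ _).trans ((hf e).v20 j)
    · exact (h2 _ _).trans ((hf e).v11 j)
    · exact (h2 _ _).trans ((hf e).v02 j)
  · intro k l
    obtain ⟨e, j, rfl⟩ := exists_side hM hel k
    rw [← (hf e).valR j l, ← hR,
      ← hφ e _ ((el e).mem_side j (Ioo_subset_Icc_self (E.R_mem ((el e).edgeIdx j) l)))]
    exact congrArg φ ((el e).map_side j _).symm
  · intro k l
    obtain ⟨e, j, rfl⟩ := exists_side hM hel k
    rw [← (hf e).normalS j l, ← hS, hgs e j _ _ (E.S_mem _ l)]
  · intro ψ hψ hI y hy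
    rw [closure_eq_iUnion hM hel] at hy
    obtain ⟨e, x, hx, rfl⟩ := mem_iUnion.1 hy
    obtain ⟨g, hgP, hgψ⟩ := (hpol ψ).1 ⟨hψ.tri, hψ.quad⟩ e
    have hgs := localSol_of_interpolates hM hel hR hS hψ hI hgP hgψ
      ((hpt ψ).1 ⟨hI.quads, hI.triangles⟩ e)
    rw [hgψ x hx, hφ e x hx, hgs.unique hp hM.edge_ne (hf e)]

end Global

/-! ### Bivariate polynomial functions -/

/-- Bivariate polynomials as functions on `ℝ × ℝ`. -/
def evalFun : MvPolynomial (Fin 2) ℝ →ₗ[ℝ] (ℝ × ℝ → ℝ) where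
  toFun q x := MvPolynomial.eval ![x.1, x.2] q
  map_add' a b := by ext; simp
  map_smul' c a := by ext; simp

theorem evalFun_injective : Function.Injective evalFun := by
  intro a b h
  refine MvPolynomial.funext fun x => ?_
  have := congrFun h (x 0, x 1)
  have hx : ![x 0, x 1] = x := by
    ext i
    fin_cases i <;> rfl
  simpa [evalFun, hx] using this

/-- The space of polynomial functions whose monomials have exponents in `s`. -/
def polySpace (s : Set (Fin 2 →₀ ℕ)) : Submodule ℝ (ℝ × ℝ → ℝ) :=
  (MvPolynomial.restrictSupport ℝ s).map evalFun

theorem finrank_polySpace (s : Set (Fin 2 →₀ ℕ)) :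
    Module.finrank ℝ (polySpace s) = Nat.card s := by
  rw [polySpace, ← (Submodule.equivMapOfInjective evalFun evalFun_injective _).finrank_eq]
  exact Module.finrank_eq_nat_card_basis (MvPolynomial.basisRestrictSupport ℝ s)

theorem finite_polySpace {s : Set (Fin 2 →₀ ℕ)} [Finite s] :
    FiniteDimensional ℝ (polySpace s) := by
  have : FiniteDimensional ℝ (MvPolynomial.restrictSupport ℝ s) :=
    Module.Finite.of_basis (MvPolynomial.basisRestrictSupport ℝ s)
  exact Module.Finite.map _ _

/-- A subspace contains `polySpace s` as soon as it contains the monomials. -/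
theorem polySpace_le {s : Set (Fin 2 →₀ ℕ)} {W : Submodule ℝ (ℝ × ℝ → ℝ)}
    (h : ∀ a ∈ s, (fun x : ℝ × ℝ => x.1 ^ a 0 * x.2 ^ a 1) ∈ W) : polySpace s ≤ W := by
  rintro _ ⟨q, hq, rfl⟩
  have : evalFun q = ∑ d ∈ q.support, MvPolynomial.coeff d q •
      fun x : ℝ × ℝ => x.1 ^ d 0 * x.2 ^ d 1 := by
    ext x
    simp [evalFun, MvPolynomial.eval_eq']
  rw [this]
  exact W.sum_mem fun d hd => W.smul_mem _ (h d (hq hd))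

theorem contDiff_polySpace {s : Set (Fin 2 →₀ ℕ)} {f : ℝ × ℝ → ℝ} (hf : f ∈ polySpace s) :
    ContDiff ℝ 2 f := by
  let W : Submodule ℝ (ℝ × ℝ → ℝ) :=
    { carrier := {f | ContDiff ℝ 2 f}
      add_mem' := fun {f g} (h1 : ContDiff ℝ 2 f) (h2 : ContDiff ℝ 2 g) =>
        (h1.add h2 : ContDiff ℝ 2 (f + g))
      zero_mem' := (contDiff_const : ContDiff ℝ 2 fun _ : ℝ × ℝ => (0 : ℝ))
      smul_mem' := fun c f (h : ContDiff ℝ 2 f) => (h.const_smul c : ContDiff ℝ 2 (c • f)) }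
  refine polySpace_le (W := W) (fun a _ => ?_) hf
  have h : ContDiff ℝ 2 fun x : ℝ × ℝ => x.1 ^ a 0 * x.2 ^ a 1 :=
    (contDiff_fst.pow _).mul (contDiff_snd.pow _)
  exact h

/-- Exponents of total degree at most `p`. -/
def totExp (p : ℕ) : Set (Fin 2 →₀ ℕ) := {a | a 0 + a 1 ≤ p}

/-- Exponents of bi-degree at most `(p, p)`. -/
def biExp (p : ℕ) : Set (Fin 2 →₀ ℕ) := {a | a 0 ≤ p ∧ a 1 ≤ p}

theorem isPolyTotal_iff {p : ℕ} {D : Set (ℝ × ℝ)} {g : ℝ × ℝ → ℝ} :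
    IsPolyTotal p D g ↔ ∃ f ∈ polySpace (totExp p), ∀ x ∈ D, g x = f x := by
  constructor
  · rintro ⟨q, hq, h⟩
    refine ⟨evalFun q, ⟨q, fun m hm => ?_, rfl⟩, h⟩
    have := (MvPolynomial.le_totalDegree hm).trans hq
    rwa [Finsupp.sum_fintype _ _ (fun _ => rfl), Fin.sum_univ_two] at this
  · rintro ⟨_, ⟨q, hq, rfl⟩, h⟩
    refine ⟨q, Finset.sup_le fun m hm => ?_, h⟩
    rw [Finsupp.sum_fintype _ _ (fun _ => rfl), Fin.sum_univ_two]
    exact hq hm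

theorem isPolyBi_iff {p : ℕ} {D : Set (ℝ × ℝ)} {g : ℝ × ℝ → ℝ} :
    IsPolyBi p D g ↔ ∃ f ∈ polySpace (biExp p), ∀ x ∈ D, g x = f x := by
  constructor
  · rintro ⟨q, hq, h⟩
    exact ⟨evalFun q, ⟨q, fun m hm => ⟨MvPolynomial.degreeOf_le_iff.1 (hq 0) m hm,
      MvPolynomial.degreeOf_le_iff.1 (hq 1) m hm⟩, rfl⟩, h⟩
  · rintro ⟨_, ⟨q, hq, rfl⟩, h⟩
    refine ⟨q, fun j => MvPolynomial.degreeOf_le_iff.2 fun m hm => ?_, h⟩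
    fin_cases j
    · exact (hq hm).1
    · exact (hq hm).2

/-- Exponents as pairs of natural numbers. -/
def expEquiv : (Fin 2 →₀ ℕ) ≃ ℕ × ℕ := Finsupp.equivFunOnFinite.trans (finTwoArrowEquiv ℕ)

/-- Enumeration of the exponents of bi-degree at most `(p, p)`. -/
def biExpEquiv (p : ℕ) : biExp p ≃ Fin (p + 1) × Fin (p + 1) where
  toFun a := (⟨a.1 0, Nat.lt_succ_of_le a.2.1⟩, ⟨a.1 1, Nat.lt_succ_of_le a.2.2⟩)
  invFun b := ⟨expEquiv.symm (b.1, b.2), Nat.le_of_lt_succ b.1.2, Nat.le_of_lt_succ b.2.2⟩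
  left_inv a := Subtype.ext (expEquiv.symm_apply_apply a.1)
  right_inv _ := rfl

/-- Enumeration of the exponents of total degree at most `p`, by the first exponent. -/
def totExpEquiv (p : ℕ) : totExp p ≃ Σ i : Fin (p + 1), Fin (p + 1 - i) where
  toFun a := ⟨⟨a.1 0, by have := a.2; simp only [totExp, mem_ofPred_eq] at this; omega⟩,
    ⟨a.1 1, by have := a.2; simp only [totExp, mem_ofPred_eq] at this; simp only; omega⟩⟩
  invFun b := ⟨expEquiv.symm (b.1, b.2), by
    have h : (b.1 : ℕ) + b.2 ≤ p := by have := b.2.2; omega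
    exact h⟩
  left_inv a := Subtype.ext (expEquiv.symm_apply_apply a.1)
  right_inv _ := rfl

instance (p : ℕ) : Finite (biExp p) := Finite.of_equiv _ (biExpEquiv p).symm

instance (p : ℕ) : Finite (totExp p) := Finite.of_equiv _ (totExpEquiv p).symm

theorem finrank_bi (p : ℕ) : Module.finrank ℝ (polySpace (biExp p)) = (p + 1) * (p + 1) := by
  rw [finrank_polySpace, Nat.card_congr (biExpEquiv p)]
  simp

theorem finrank_tot (p : ℕ) :
    Module.finrank ℝ (polySpace (totExp p)) * 2 = (p + 1) * (p + 2) := by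
  rw [finrank_polySpace, Nat.card_congr (totExpEquiv p), Nat.card_eq_fintype_card,
    Fintype.card_sigma]
  simp only [Fintype.card_fin]
  rw [Fin.sum_univ_eq_sum_range (fun i => p + 1 - i), ← Finset.sum_range_reflect]
  have : ∑ j ∈ Finset.range (p + 1), (p + 1 - (p + 1 - 1 - j))
      = ∑ j ∈ Finset.range (p + 1), (j + 1) := by
    refine Finset.sum_congr rfl fun j hj => ?_
    have := Finset.mem_range.1 hj
    omega
  rw [this, ← Finset.sum_range_succ' (fun j => j) (p + 1) |>.trans (add_zero _),
    Finset.sum_range_id_mul_two]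
  simp [mul_comm]

/-! ### Polynomials along line segments -/

open Polynomial in
/-- The affine polynomial with values `a` at `0` and `b` at `1`. -/
def segPoly (a b : ℝ) : ℝ[X] := C (b - a) * X + C a

open Polynomial in
theorem eval_segPoly (a b t : ℝ) : (segPoly a b).eval t = (1 - t) * a + t * b := by
  simp [segPoly]
  ring

open Polynomial in
theorem natDegree_segPoly_pow (a b : ℝ) (i : ℕ) : (segPoly a b ^ i).natDegree ≤ i :=
  natDegree_pow_le_of_le i natDegree_linear_le |>.trans (by simp)

open Polynomial in
theorem natDegree_segPoly_self (a : ℝ) (i : ℕ) : (segPoly a a ^ i).natDegree = 0 := by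
  rw [segPoly, sub_self, C_0, zero_mul, zero_add, ← C_pow, natDegree_C]

theorem segment_coord (A B : ℝ × ℝ) (t : ℝ) :
    ((1 - t) • A + t • B).1 = (segPoly A.1 B.1).eval t ∧
    ((1 - t) • A + t • B).2 = (segPoly A.2 B.2).eval t := by
  simp [eval_segPoly]

/-- The space of functions whose restriction to the line through `A` and `B` is a polynomial of
degree at most `d`. -/
def traceSpace (d : ℕ) (A B : ℝ × ℝ) : Submodule ℝ (ℝ × ℝ → ℝ) where
  carrier := {f | ∃ q : Polynomial ℝ, q.natDegree ≤ d ∧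
    ∀ t : ℝ, f ((1 - t) • A + t • B) = q.eval t}
  add_mem' := by
    rintro f g ⟨q, hq, h⟩ ⟨q', hq', h'⟩
    exact ⟨q + q', (Polynomial.natDegree_add_le _ _).trans (max_le hq hq'), fun t => by
      simp [h, h']⟩
  zero_mem' := ⟨0, by simp, by simp⟩
  smul_mem' := by
    rintro c f ⟨q, hq, h⟩
    exact ⟨c • q, (Polynomial.natDegree_smul_le _ _).trans hq, fun t => by simp [h]⟩

/-- The space of differentiable functions whose derivative in the direction `w`, restricted to
the line through `A` and `B`, is a polynomial of degree at most `d`. -/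
def derivTraceSpace (d : ℕ) (A B w : ℝ × ℝ) : Submodule ℝ (ℝ × ℝ → ℝ) where
  carrier := {f | Differentiable ℝ f ∧ ∃ q : Polynomial ℝ, q.natDegree ≤ d ∧
    ∀ t : ℝ, fderiv ℝ f ((1 - t) • A + t • B) w = q.eval t}
  add_mem' := by
    rintro f g ⟨hf, q, hq, h⟩ ⟨hg, q', hq', h'⟩
    exact ⟨hf.add hg, q + q', (Polynomial.natDegree_add_le _ _).trans (max_le hq hq'), fun t => by
      rw [fderiv_add (hf _) (hg _), add_apply, h, h', Polynomial.eval_add]⟩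
  zero_mem' := ⟨differentiable_const _, 0, by simp, fun t => by
    rw [fderiv_zero]; simp⟩
  smul_mem' := by
    rintro c f ⟨hf, q, hq, h⟩
    exact ⟨hf.const_smul c, c • q, (Polynomial.natDegree_smul_le _ _).trans hq, fun t => by
      rw [fderiv_const_smul (hf _), smul_apply, h, Polynomial.eval_smul]⟩

theorem fderiv_monomial (i j : ℕ) (x w : ℝ × ℝ) :
    fderiv ℝ (fun x : ℝ × ℝ => x.1 ^ i * x.2 ^ j) x w
      = i * w.1 * (x.1 ^ (i - 1) * x.2 ^ j) + j * w.2 * (x.1 ^ i * x.2 ^ (j - 1)) := by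
  have h1 := (hasFDerivAt_fst (𝕜 := ℝ) (p := x)).pow i
  have h2 := (hasFDerivAt_snd (𝕜 := ℝ) (p := x)).pow j
  have h : HasFDerivAt (fun x : ℝ × ℝ => x.1 ^ i * x.2 ^ j) _ x := h1.mul h2
  rw [h.fderiv]
  simp
  ring

open Polynomial in
/-- The derivative of a polynomial of total degree at most `p` has degree at most `p - 1` along
every line. -/
theorem tot_le_derivTraceSpace (p : ℕ) (A B w : ℝ × ℝ) :
    polySpace (totExp p) ≤ derivTraceSpace (p - 1) A B w := by
  refine polySpace_le fun a ha => ⟨by fun_prop, ?_⟩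
  have ha' : a 0 + a 1 ≤ p := ha
  refine ⟨C (a 0 * w.1) * (segPoly A.1 B.1 ^ (a 0 - 1) * segPoly A.2 B.2 ^ a 1)
    + C (a 1 * w.2) * (segPoly A.1 B.1 ^ a 0 * segPoly A.2 B.2 ^ (a 1 - 1)), ?_, fun t => ?_⟩
  · refine (natDegree_add_le _ _).trans (max_le ?_ ?_)
    · rcases Nat.eq_zero_or_pos (a 0) with h0 | h0
      · simp [h0]
      refine (natDegree_C_mul_le _ _).trans (natDegree_mul_le.trans ?_)
      have h1 := natDegree_segPoly_pow A.1 B.1 (a 0 - 1)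
      have h2 := natDegree_segPoly_pow A.2 B.2 (a 1)
      omega
    · rcases Nat.eq_zero_or_pos (a 1) with h0 | h0
      · simp [h0]
      refine (natDegree_C_mul_le _ _).trans (natDegree_mul_le.trans ?_)
      have h1 := natDegree_segPoly_pow A.1 B.1 (a 0)
      have h2 := natDegree_segPoly_pow A.2 B.2 (a 1 - 1)
      omega
  · rw [fderiv_monomial, (segment_coord A B t).1, (segment_coord A B t).2]
    simp

open Polynomial in
theorem tot_le_traceSpace (p : ℕ) (A B : ℝ × ℝ) :
    polySpace (totExp p) ≤ traceSpace p A B := by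
  refine polySpace_le fun a ha => ?_
  have ha' : a 0 + a 1 ≤ p := ha
  refine ⟨segPoly A.1 B.1 ^ a 0 * segPoly A.2 B.2 ^ a 1, natDegree_mul_le.trans ?_, fun t => ?_⟩
  · have h1 := natDegree_segPoly_pow A.1 B.1 (a 0)
    have h2 := natDegree_segPoly_pow A.2 B.2 (a 1)
    omega
  · simp only [(segment_coord A B t).1, (segment_coord A B t).2, eval_mul, eval_pow]

open Polynomial in
theorem natDegree_segPoly_mul {A B : ℝ × ℝ} (hAB : A.1 = B.1 ∨ A.2 = B.2) {i j p : ℕ}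
    (hi : i ≤ p) (hj : j ≤ p) :
    (segPoly A.1 B.1 ^ i * segPoly A.2 B.2 ^ j).natDegree ≤ p := by
  refine natDegree_mul_le.trans ?_
  have h1 := natDegree_segPoly_pow A.1 B.1 i
  have h2 := natDegree_segPoly_pow A.2 B.2 j
  rcases hAB with h | h
  · rw [h, natDegree_segPoly_self]
    omega
  · rw [h, natDegree_segPoly_self]
    omega

open Polynomial in
theorem bi_le_traceSpace (p : ℕ) {A B : ℝ × ℝ} (hAB : A.1 = B.1 ∨ A.2 = B.2) :
    polySpace (biExp p) ≤ traceSpace p A B := by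
  refine polySpace_le fun a ha => ⟨_, natDegree_segPoly_mul hAB ha.1 ha.2, fun t => ?_⟩
  simp only [(segment_coord A B t).1, (segment_coord A B t).2, eval_mul, eval_pow]

open Polynomial in
/-- The derivative of a polynomial of bi-degree at most `(p, p)` has degree at most `p` along
lines parallel to the axes. -/
theorem bi_le_derivTraceSpace (p : ℕ) {A B : ℝ × ℝ} (hAB : A.1 = B.1 ∨ A.2 = B.2)
    (w : ℝ × ℝ) : polySpace (biExp p) ≤ derivTraceSpace p A B w := by
  refine polySpace_le fun a ha => ⟨by fun_prop, ?_⟩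
  have h1 : a 0 - 1 ≤ p := (Nat.sub_le _ _).trans ha.1
  have h2 : a 1 - 1 ≤ p := (Nat.sub_le _ _).trans ha.2
  refine ⟨C (a 0 * w.1) * (segPoly A.1 B.1 ^ (a 0 - 1) * segPoly A.2 B.2 ^ a 1)
    + C (a 1 * w.2) * (segPoly A.1 B.1 ^ a 0 * segPoly A.2 B.2 ^ (a 1 - 1)), ?_, fun t => ?_⟩
  · exact (natDegree_add_le _ _).trans (max_le
      ((natDegree_C_mul_le _ _).trans (natDegree_segPoly_mul hAB h1 ha.2))
      ((natDegree_C_mul_le _ _).trans (natDegree_segPoly_mul hAB ha.1 h2)))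
  · rw [fderiv_monomial, (segment_coord A B t).1, (segment_coord A B t).2]
    simp

/-! ### Boundary layers of Bernstein coefficients -/

theorem coeff_eq_zero_of_sum_layer {α : Type*} {S : Finset α} {c : α → ℝ} {i : α → ℕ} {n : ℕ}
    (hinj : ∀ a ∈ S, ∀ b ∈ S, i a = i b → a = b) (hi : ∀ a ∈ S, i a ≤ n)
    (h : ∀ t ∈ Ioo (0 : ℝ) 1, ∑ a ∈ S, c a * (t ^ i a * (1 - t) ^ (n - i a)) = 0) :
    ∀ a ∈ S, c a = 0 := by
  have key := coeff_eq_zero_of_sum_bernstein (n := n) (c := fun k => ∑ a ∈ S with i a = k, c a) ?_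
  · intro a ha
    have h1 := key (i a) (hi a ha)
    have h2 : S.filter (fun b => i b = i a) = {a} := by
      ext b
      simp only [Finset.mem_filter, Finset.mem_singleton]
      exact ⟨fun hb => hinj b hb.1 a ha hb.2, by rintro rfl; exact ⟨ha, rfl⟩⟩
    simpa [h2] using h1
  · intro t ht
    rw [← h t ht, ← Finset.sum_fiberwise_of_maps_to (t := Finset.range (n + 1)) (g := i)
      (fun a ha => Finset.mem_range.2 (Nat.lt_succ_of_le (hi a ha)))]
    refine Finset.sum_congr rfl fun k _ => ?_
    rw [Finset.sum_mul]
    refine Finset.sum_congr rfl fun a ha => ?_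
    rw [(Finset.mem_filter.1 ha).2]

/-- If `f` vanishes to first order on a side `y` of the reference domain, then its Bernstein
coefficients in the two layers next to this side vanish. Here `s` is a coordinate
transversal to the side, `r a` is the exponent of `s` in the Bernstein function with index `a`,
and for `s = 0` the remaining factor `g a t s` is a univariate Bernstein function, up to
normalization. -/
theorem coeff_eq_zero_of_boundary {α : Type*} [Fintype α] {c : α → ℝ} {r i : α → ℕ} {n : ℕ → ℕ}
    {g : α → ℝ → ℝ → ℝ} {f : ℝ × ℝ → ℝ} {y : ℝ → ℝ × ℝ} {w : ℝ × ℝ}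
    (hinj : ∀ a b, r a = r b → i a = i b → a = b) (hi : ∀ a, i a ≤ n (r a))
    (hg0 : ∀ a t, g a t 0 = t ^ i a * (1 - t) ^ (n (r a) - i a))
    (hgd : ∀ a t, Differentiable ℝ (g a t)) (hf : Differentiable ℝ f)
    (hexp : ∀ t s, f (y t + s • w) = ∑ a, c a * (s ^ r a * g a t s))
    (h0 : ∀ t ∈ Ioo (0 : ℝ) 1, f (y t) = 0 ∧ fderiv ℝ f (y t) = 0) :
    ∀ a, r a ≤ 1 → c a = 0 := by
  have layer : ∀ ρ, (∀ t ∈ Ioo (0 : ℝ) 1, ∑ a with r a = ρ, c a * g a t 0 = 0) →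
      ∀ a, r a = ρ → c a = 0 := by
    intro ρ h a ha
    refine coeff_eq_zero_of_sum_layer (S := {a | r a = ρ}) (i := i) (n := n ρ) ?_ ?_ ?_ a
      (by simpa using ha)
    · intro a ha b hb hab
      simp only [Finset.mem_filter, Finset.mem_univ, true_and] at ha hb
      exact hinj a b (ha.trans hb.symm) hab
    · intro a ha
      simp only [Finset.mem_filter, Finset.mem_univ, true_and] at ha
      exact ha ▸ hi a
    · intro t ht
      rw [← h t ht]
      refine Finset.sum_congr rfl fun a ha => ?_
      simp only [Finset.mem_filter, Finset.mem_univ, true_and] at ha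
      rw [hg0, ha]
  have c0 : ∀ a, r a = 0 → c a = 0 := by
    refine layer 0 fun t ht => ?_
    have h := hexp t 0
    rw [zero_smul, add_zero, (h0 t ht).1] at h
    refine Eq.trans ?_ h.symm
    rw [Finset.sum_filter]
    refine Finset.sum_congr rfl fun a _ => ?_
    split_ifs with ha <;> simp [ha]
  have c1 : ∀ a, r a = 1 → c a = 0 := by
    refine layer 1 fun t ht => ?_
    -- After division by `s`, the transversal derivative is the value at `s = 0`.
    have e : (fun s : ℝ => f (y t + s • w))
        = fun s => s * ∑ a, c a * (s ^ (r a - 1) * g a t s) := by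
      ext s
      rw [hexp, Finset.mul_sum]
      refine Finset.sum_congr rfl fun a _ => ?_
      rcases Nat.eq_zero_or_pos (r a) with ha | ha
      · simp [c0 a ha]
      · conv_lhs => rw [← Nat.sub_add_cancel ha, pow_succ]
        ring
    have d1 : HasDerivAt (fun s : ℝ => f (y t + s • w)) 0 0 := by
      have hl : HasDerivAt (fun s : ℝ => y t + s • w) w 0 := by
        simpa using ((hasDerivAt_id (0 : ℝ)).smul_const w).const_add (y t)
      have := (hf (y t + (0 : ℝ) • w)).hasFDerivAt.comp_hasDerivAt (0 : ℝ) hl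
      simpa [(h0 t ht).2, Function.comp_def] using this
    have hk : Differentiable ℝ fun s => ∑ a, c a * (s ^ (r a - 1) * g a t s) := by
      refine Differentiable.fun_sum fun a _ => ?_
      have := hgd a t
      fun_prop
    have d2 := (hasDerivAt_id (0 : ℝ)).mul (hk 0).hasDerivAt
    have hz := (e ▸ d1).unique d2
    simp only [id, zero_mul, one_mul, add_zero] at hz
    refine Eq.trans ?_ hz.symm
    rw [Finset.sum_filter]
    refine Finset.sum_congr rfl fun a _ => ?_
    split_ifs with ha
    · simp [ha]
    · rcases Nat.eq_zero_or_pos (r a) with h | h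
      · simp [c0 a h]
      · have : r a - 1 ≠ 0 := by omega
        simp [this]
  intro a ha
  rcases Nat.le_one_iff_eq_zero_or_eq_one.1 ha with h | h
  · exact c0 a h
  · exact c1 a h

/-! ### Polynomials vanishing to first order on the boundary -/

/-- The corners of the parameter square, in cyclic order. -/
def squareCorner : Fin 4 → ℝ × ℝ := ![(0, 0), (1, 0), (1, 1), (0, 1)]

/-- The corners of the parameter triangle. -/
def triangleCorner : Fin 3 → ℝ × ℝ := ![(0, 0), (1, 0), (0, 1)]

/-- The tensor-product Bernstein functions without their normalization. -/
def bernMonoQuad (p : ℕ) (a : Fin (p + 1) × Fin (p + 1)) (x : ℝ × ℝ) : ℝ :=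
  x.1 ^ (a.1 : ℕ) * (1 - x.1) ^ (p - a.1) * (x.2 ^ (a.2 : ℕ) * (1 - x.2) ^ (p - a.2))

theorem bi_le_span_bernMonoQuad (p : ℕ) :
    polySpace (biExp p) ≤ Submodule.span ℝ (range (bernMonoQuad p)) := by
  set T := Submodule.span ℝ (range (bernMonoQuad p)) with hT
  -- The degrees in `u, 1 - u` and in `v, 1 - v` are raised by inserting `u + (1 - u) = 1`.
  have step2 : ∀ m a b c d : ℕ, a + b = p → c + d + m = p →
      (fun x : ℝ × ℝ => x.1 ^ a * (1 - x.1) ^ b * (x.2 ^ c * (1 - x.2) ^ d)) ∈ T := by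
    intro m
    induction m with
    | zero =>
      intro a b c d h1 h2
      refine Submodule.subset_span ⟨(⟨a, by omega⟩, ⟨c, by omega⟩), ?_⟩
      ext x
      have e1 : p - a = b := by omega
      have e2 : p - c = d := by omega
      simp only [bernMonoQuad, e1, e2]
    | succ m ih =>
      intro a b c d h1 h2
      convert T.add_mem (ih a b (c + 1) d h1 (by omega)) (ih a b c (d + 1) h1 (by omega)) using 1
      ext x
      simp only [Pi.add_apply]
      ring
  have step1 : ∀ n a b c d m : ℕ, a + b + n = p → c + d + m = p →
      (fun x : ℝ × ℝ => x.1 ^ a * (1 - x.1) ^ b * (x.2 ^ c * (1 - x.2) ^ d)) ∈ T := by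
    intro n
    induction n with
    | zero => exact fun a b c d m h1 h2 => step2 m a b c d h1 h2
    | succ n ih =>
      intro a b c d m h1 h2
      convert T.add_mem (ih (a + 1) b c d m (by omega) h2) (ih a (b + 1) c d m (by omega) h2)
        using 1
      ext x
      simp only [Pi.add_apply]
      ring
  refine polySpace_le fun a ha => ?_
  have h1 : a 0 ≤ p := ha.1
  have h2 : a 1 ≤ p := ha.2
  simpa using step1 (p - a 0) (a 0) 0 (a 1) 0 (p - a 1) (by omega) (by omega)

/-- A polynomial of bi-degree at most `(p, p)` that vanishes to first order on the boundary of
the square is a combination of the interior Bernstein functions. -/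
theorem mem_interiorQuad {p : ℕ} {f : ℝ × ℝ → ℝ} (hf : f ∈ polySpace (biExp p))
    (h : ∀ j, ∀ t ∈ Icc (0 : ℝ) 1, f ((1 - t) • squareCorner j + t • squareCorner (j + 1)) = 0 ∧
      fderiv ℝ f ((1 - t) • squareCorner j + t • squareCorner (j + 1)) = 0) :
    f ∈ interiorQuad p := by
  have hd : Differentiable ℝ f := (contDiff_polySpace hf).differentiable (by norm_num)
  obtain ⟨c, hc⟩ := (Submodule.mem_span_range_iff_exists_fun ℝ).1 (bi_le_span_bernMonoQuad p hf)
  have hfx : ∀ x, f x = ∑ a, c a * bernMonoQuad p a x := fun x => by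
    rw [← hc]
    simp
  have hb : ∀ a : Fin (p + 1) × Fin (p + 1), (a.1 : ℕ) ≤ p ∧ (a.2 : ℕ) ≤ p := fun a =>
    ⟨Nat.le_of_lt_succ a.1.2, Nat.le_of_lt_succ a.2.2⟩
  have hext : ∀ a b : Fin (p + 1) × Fin (p + 1), (a.1 : ℕ) = b.1 → (a.2 : ℕ) = b.2 → a = b :=
    fun a b h1 h2 => Prod.ext (Fin.ext h1) (Fin.ext h2)
  have mem : ∀ t ∈ Ioo (0 : ℝ) 1, t ∈ Icc (0 : ℝ) 1 ∧ 1 - t ∈ Icc (0 : ℝ) 1 := fun t ht =>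
    ⟨Ioo_subset_Icc_self ht, by linarith [ht.2], by linarith [ht.1]⟩
  have s0 : ∀ t ∈ Ioo (0 : ℝ) 1, f (t, 0) = 0 ∧ fderiv ℝ f (t, 0) = 0 := fun t ht => by
    simpa [squareCorner] using h 0 t (mem t ht).1
  have s1 : ∀ t ∈ Ioo (0 : ℝ) 1, f (1, t) = 0 ∧ fderiv ℝ f (1, t) = 0 := fun t ht => by
    simpa [squareCorner] using h 1 t (mem t ht).1
  have s2 : ∀ t ∈ Ioo (0 : ℝ) 1, f (t, 1) = 0 ∧ fderiv ℝ f (t, 1) = 0 := fun t ht => by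
    simpa [squareCorner] using h 2 (1 - t) (mem t ht).2
  have s3 : ∀ t ∈ Ioo (0 : ℝ) 1, f (0, t) = 0 ∧ fderiv ℝ f (0, t) = 0 := fun t ht => by
    simpa [squareCorner] using h 3 (1 - t) (mem t ht).2
  have c0 : ∀ a, (a.2 : ℕ) ≤ 1 → c a = 0 := by
    refine coeff_eq_zero_of_boundary (c := c) (r := fun a => a.2) (i := fun a => a.1)
      (n := fun _ => p) (w := (0, 1))
      (g := fun a t s => t ^ (a.1 : ℕ) * (1 - t) ^ (p - a.1) * (1 - s) ^ (p - a.2))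
      (fun a b h1 h2 => hext a b h2 h1) (fun a => (hb a).1) (fun a t => by simp)
      (fun a t => by fun_prop) hd (fun t s => ?_) s0
    rw [hfx]
    refine Finset.sum_congr rfl fun a _ => ?_
    refine congrArg (c a * ·) ?_
    simp only [bernMonoQuad, Prod.mk_add_mk, Prod.smul_mk, smul_eq_mul]
    ring
  have c1 : ∀ a, p - (a.1 : ℕ) ≤ 1 → c a = 0 := by
    refine coeff_eq_zero_of_boundary (c := c) (r := fun a => p - a.1) (i := fun a => a.2)
      (n := fun _ => p) (w := (-1, 0))
      (g := fun a t s => (1 - s) ^ (a.1 : ℕ) * (t ^ (a.2 : ℕ) * (1 - t) ^ (p - a.2)))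
      (fun a b h1 h2 => hext a b (by have := (hb a).1; have := (hb b).1; omega) h2)
      (fun a => (hb a).2) (fun a t => by simp)
      (fun a t => by fun_prop) hd (fun t s => ?_) s1
    rw [hfx]
    refine Finset.sum_congr rfl fun a _ => ?_
    refine congrArg (c a * ·) ?_
    simp only [bernMonoQuad, Prod.mk_add_mk, Prod.smul_mk, smul_eq_mul]
    ring
  have c2 : ∀ a, p - (a.2 : ℕ) ≤ 1 → c a = 0 := by
    refine coeff_eq_zero_of_boundary (c := c) (r := fun a => p - a.2) (i := fun a => a.1)
      (n := fun _ => p) (w := (0, -1))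
      (g := fun a t s => (1 - s) ^ (a.2 : ℕ) * (t ^ (a.1 : ℕ) * (1 - t) ^ (p - a.1)))
      (fun a b h1 h2 => hext a b h2 (by have := (hb a).2; have := (hb b).2; omega))
      (fun a => (hb a).1) (fun a t => by simp)
      (fun a t => by fun_prop) hd (fun t s => ?_) s2
    rw [hfx]
    refine Finset.sum_congr rfl fun a _ => ?_
    refine congrArg (c a * ·) ?_
    simp only [bernMonoQuad, Prod.mk_add_mk, Prod.smul_mk, smul_eq_mul]
    ring
  have c3 : ∀ a, (a.1 : ℕ) ≤ 1 → c a = 0 := by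
    refine coeff_eq_zero_of_boundary (c := c) (r := fun a => a.1) (i := fun a => a.2)
      (n := fun _ => p) (w := (1, 0))
      (g := fun a t s => (1 - s) ^ (p - a.1) * (t ^ (a.2 : ℕ) * (1 - t) ^ (p - a.2)))
      (fun a b h1 h2 => hext a b h1 h2) (fun a => (hb a).2) (fun a t => by simp)
      (fun a t => by fun_prop) hd (fun t s => ?_) s3
    rw [hfx]
    refine Finset.sum_congr rfl fun a _ => ?_
    refine congrArg (c a * ·) ?_
    simp only [bernMonoQuad, Prod.mk_add_mk, Prod.smul_mk, smul_eq_mul]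
    ring
  rw [← hc]
  refine Submodule.sum_mem _ fun a _ => ?_
  by_cases ha : c a = 0
  · rw [ha, zero_smul]
    exact Submodule.zero_mem _
  refine Submodule.smul_mem _ _ ?_
  have hC : (p.choose a.1 : ℝ) * p.choose a.2 ≠ 0 := by
    have h1 := (Nat.choose_pos (hb a).1).ne'
    have h2 := (Nat.choose_pos (hb a).2).ne'
    positivity
  have e : bernMonoQuad p a = ((p.choose a.1 : ℝ) * p.choose a.2)⁻¹ • bernQuad p a.1 a.2 := by
    ext x
    simp only [bernMonoQuad, Pi.smul_apply, smul_eq_mul, bernQuad, bern]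
    rw [eq_inv_mul_iff_mul_eq₀ hC]
    ring
  rw [e]
  refine Submodule.smul_mem _ _ (Submodule.subset_span ⟨a.1, a.2, ?_, ?_, ?_, ?_, rfl⟩)
  · by_contra hlt
    exact ha (c3 a (by omega))
  · by_contra hlt
    exact ha (c1 a (by omega))
  · by_contra hlt
    exact ha (c0 a (by omega))
  · by_contra hlt
    exact ha (c2 a (by omega))

/-- The triangle Bernstein functions without their normalization. -/
def bernMonoTri (p : ℕ) (a : Finset.Nat.antidiagonalTuple 3 p) (x : ℝ × ℝ) : ℝ :=
  x.1 ^ a.1 0 * x.2 ^ a.1 1 * (1 - x.1 - x.2) ^ a.1 2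

theorem sum_tri {p : ℕ} (a : Finset.Nat.antidiagonalTuple 3 p) :
    a.1 0 + a.1 1 + a.1 2 = p := by
  have := Finset.Nat.mem_antidiagonalTuple.1 a.2
  rwa [Fin.sum_univ_three] at this

theorem tot_le_span_bernMonoTri (p : ℕ) :
    polySpace (totExp p) ≤ Submodule.span ℝ (range (bernMonoTri p)) := by
  set T := Submodule.span ℝ (range (bernMonoTri p)) with hT
  have step : ∀ n a b c : ℕ, a + b + c + n = p →
      (fun x : ℝ × ℝ => x.1 ^ a * x.2 ^ b * (1 - x.1 - x.2) ^ c) ∈ T := by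
    intro n
    induction n with
    | zero =>
      intro a b c h
      refine Submodule.subset_span ⟨⟨![a, b, c], ?_⟩, ?_⟩
      · rw [Finset.Nat.mem_antidiagonalTuple, Fin.sum_univ_three]
        exact h
      · rfl
    | succ n ih =>
      intro a b c h
      convert T.add_mem (T.add_mem (ih (a + 1) b c (by omega)) (ih a (b + 1) c (by omega)))
        (ih a b (c + 1) (by omega)) using 1
      ext x
      simp only [Pi.add_apply]
      ring
  refine polySpace_le fun a ha => ?_
  have h1 : a 0 + a 1 ≤ p := ha
  simpa using step (p - (a 0 + a 1)) (a 0) (a 1) 0 (by omega)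

/-- A polynomial of total degree at most `p` that vanishes to first order on the boundary of the
triangle is a combination of the interior Bernstein functions. -/
theorem mem_interiorTri {p : ℕ} {f : ℝ × ℝ → ℝ} (hf : f ∈ polySpace (totExp p))
    (h : ∀ j, ∀ t ∈ Icc (0 : ℝ) 1,
      f ((1 - t) • triangleCorner j + t • triangleCorner (j + 1)) = 0 ∧
      fderiv ℝ f ((1 - t) • triangleCorner j + t • triangleCorner (j + 1)) = 0) :
    f ∈ interiorTri p := by
  have hd : Differentiable ℝ f := (contDiff_polySpace hf).differentiable (by norm_num)
  obtain ⟨c, hc⟩ := (Submodule.mem_span_range_iff_exists_fun ℝ).1 (tot_le_span_bernMonoTri p hf)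
  have hfx : ∀ x, f x = ∑ a, c a * bernMonoTri p a x := fun x => by
    rw [← hc]
    simp
  have hext : ∀ a b : Finset.Nat.antidiagonalTuple 3 p, a.1 0 = b.1 0 → a.1 1 = b.1 1 →
      a.1 2 = b.1 2 → a = b := by
    intro a b h0 h1 h2
    refine Subtype.ext (funext fun i => ?_)
    fin_cases i
    · exact h0
    · exact h1
    · exact h2
  have mem : ∀ t ∈ Ioo (0 : ℝ) 1, t ∈ Icc (0 : ℝ) 1 ∧ 1 - t ∈ Icc (0 : ℝ) 1 := fun t ht =>
    ⟨Ioo_subset_Icc_self ht, by linarith [ht.2], by linarith [ht.1]⟩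
  have s0 : ∀ t ∈ Ioo (0 : ℝ) 1, f (t, 0) = 0 ∧ fderiv ℝ f (t, 0) = 0 := fun t ht => by
    simpa [triangleCorner] using h 0 t (mem t ht).1
  have s1 : ∀ t ∈ Ioo (0 : ℝ) 1, f (t, 1 - t) = 0 ∧ fderiv ℝ f (t, 1 - t) = 0 := fun t ht => by
    simpa [triangleCorner] using h 1 (1 - t) (mem t ht).2
  have s2 : ∀ t ∈ Ioo (0 : ℝ) 1, f (0, t) = 0 ∧ fderiv ℝ f (0, t) = 0 := fun t ht => by
    simpa [triangleCorner] using h 2 (1 - t) (mem t ht).2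
  have c0 : ∀ a, a.1 1 ≤ 1 → c a = 0 := by
    refine coeff_eq_zero_of_boundary (c := c) (r := fun a => a.1 1) (i := fun a => a.1 0)
      (n := fun ρ => p - ρ) (w := (0, 1))
      (g := fun a t s => t ^ a.1 0 * (1 - t - s) ^ a.1 2)
      (fun a b h1 h2 => hext a b h2 h1 (by have := sum_tri a; have := sum_tri b; omega))
      (fun a => by have := sum_tri a; omega) (fun a t => ?_)
      (fun a t => by fun_prop) hd (fun t s => ?_) s0
    · have e : p - a.1 1 - a.1 0 = a.1 2 := by have := sum_tri a; omega
      simp [e]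
    · rw [hfx]
      refine Finset.sum_congr rfl fun a _ => ?_
      refine congrArg (c a * ·) ?_
      simp only [bernMonoTri, Prod.mk_add_mk, Prod.smul_mk, smul_eq_mul]
      ring
  have c1 : ∀ a, a.1 2 ≤ 1 → c a = 0 := by
    refine coeff_eq_zero_of_boundary (c := c) (r := fun a => a.1 2) (i := fun a => a.1 0)
      (n := fun ρ => p - ρ) (w := (0, -1))
      (g := fun a t s => t ^ a.1 0 * (1 - t - s) ^ a.1 1)
      (fun a b h1 h2 => hext a b h2 (by have := sum_tri a; have := sum_tri b; omega) h1)
      (fun a => by have := sum_tri a; omega) (fun a t => ?_)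
      (fun a t => by fun_prop) hd (fun t s => ?_) s1
    · have e : p - a.1 2 - a.1 0 = a.1 1 := by have := sum_tri a; omega
      simp [e]
    · rw [hfx]
      refine Finset.sum_congr rfl fun a _ => ?_
      refine congrArg (c a * ·) ?_
      simp only [bernMonoTri, Prod.mk_add_mk, Prod.smul_mk, smul_eq_mul]
      ring
  have c2 : ∀ a, a.1 0 ≤ 1 → c a = 0 := by
    refine coeff_eq_zero_of_boundary (c := c) (r := fun a => a.1 0) (i := fun a => a.1 1)
      (n := fun ρ => p - ρ) (w := (1, 0))
      (g := fun a t s => t ^ a.1 1 * (1 - t - s) ^ a.1 2)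
      (fun a b h1 h2 => hext a b h1 h2 (by have := sum_tri a; have := sum_tri b; omega))
      (fun a => by have := sum_tri a; omega) (fun a t => ?_)
      (fun a t => by fun_prop) hd (fun t s => ?_) s2
    · have e : p - a.1 0 - a.1 1 = a.1 2 := by have := sum_tri a; omega
      simp [e]
    · rw [hfx]
      refine Finset.sum_congr rfl fun a _ => ?_
      refine congrArg (c a * ·) ?_
      simp only [bernMonoTri, Prod.mk_add_mk, Prod.smul_mk, smul_eq_mul]
      ring
  rw [← hc]
  refine Submodule.sum_mem _ fun a _ => ?_
  by_cases ha : c a = 0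
  · rw [ha, zero_smul]
    exact Submodule.zero_mem _
  refine Submodule.smul_mem _ _ ?_
  set C : ℝ := (p.factorial : ℝ) / ((a.1 0).factorial * (a.1 1).factorial * (a.1 2).factorial)
    with hC
  have hC0 : C ≠ 0 := by positivity
  have e : bernMonoTri p a = C⁻¹ • bernTri p (a.1 0) (a.1 1) (a.1 2) := by
    ext x
    simp only [bernMonoTri, Pi.smul_apply, smul_eq_mul, bernTri, ← hC]
    field_simp
  rw [e]
  refine Submodule.smul_mem _ _ (Submodule.subset_span
    ⟨a.1 0, a.1 1, a.1 2, ?_, ?_, ?_, sum_tri a, rfl⟩)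
  · by_contra hlt
    exact ha (c2 a (by omega))
  · by_contra hlt
    exact ha (c0 a (by omega))
  · by_contra hlt
    exact ha (c1 a (by omega))

/-! ### The parametrizations of the elements -/

theorem hasFDerivAt_triangleMap (C : Fin 3 → Plane) (x : ℝ × ℝ) :
    HasFDerivAt (triangleMap C) ((ContinuousLinearMap.fst ℝ ℝ ℝ).smulRight (C 1 - C 0)
      + (ContinuousLinearMap.snd ℝ ℝ ℝ).smulRight (C 2 - C 0)) x := by
  have h1 := hasFDerivAt_fst (𝕜 := ℝ) (p := x)
  have h2 := hasFDerivAt_snd (𝕜 := ℝ) (p := x)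
  have h : HasFDerivAt (triangleMap C) _ x :=
    ((((h1.const_sub 1).sub h2).smul_const (C 0)).add (h1.smul_const (C 1))).add
      (h2.smul_const (C 2))
  refine h.congr_fderiv (ContinuousLinearMap.ext fun v => ?_)
  simp
  module

theorem hasFDerivAt_quadMap (C : Fin 4 → Plane) (x : ℝ × ℝ) :
    HasFDerivAt (quadMap C)
      ((ContinuousLinearMap.fst ℝ ℝ ℝ).smulRight
        (C 1 - C 0 + x.2 • (C 0 - C 1 + C 2 - C 3))
      + (ContinuousLinearMap.snd ℝ ℝ ℝ).smulRight
        (C 3 - C 0 + x.1 • (C 0 - C 1 + C 2 - C 3))) x := by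
  have h1 := hasFDerivAt_fst (𝕜 := ℝ) (p := x)
  have h2 := hasFDerivAt_snd (𝕜 := ℝ) (p := x)
  have h : HasFDerivAt (quadMap C) _ x :=
    (((((h1.const_sub 1).mul (h2.const_sub 1)).smul_const (C 0)).add
      ((h1.mul (h2.const_sub 1)).smul_const (C 1))).add ((h1.mul h2).smul_const (C 2))).add
      (((h1.const_sub 1).mul h2).smul_const (C 3))
  refine h.congr_fderiv (ContinuousLinearMap.ext fun v => ?_)
  simp
  module

theorem fderiv_triangleMap (C : Fin 3 → Plane) (x v : ℝ × ℝ) :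
    fderiv ℝ (triangleMap C) x v = v.1 • (C 1 - C 0) + v.2 • (C 2 - C 0) := by
  rw [(hasFDerivAt_triangleMap C x).fderiv]
  simp

theorem fderiv_quadMap (C : Fin 4 → Plane) (x v : ℝ × ℝ) :
    fderiv ℝ (quadMap C) x v = v.1 • (C 1 - C 0 + x.2 • (C 0 - C 1 + C 2 - C 3))
      + v.2 • (C 3 - C 0 + x.1 • (C 0 - C 1 + C 2 - C 3)) := by
  rw [(hasFDerivAt_quadMap C x).fderiv]
  simp

theorem contDiff_triangleMap (C : Fin 3 → Plane) : ContDiff ℝ 2 (triangleMap C) := by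
  unfold triangleMap
  fun_prop

theorem contDiff_quadMap (C : Fin 4 → Plane) : ContDiff ℝ 2 (quadMap C) := by
  unfold quadMap
  fun_prop

theorem isInvertible_of_jacobianDet {F : ℝ × ℝ → Plane} {x : ℝ × ℝ} (h : jacobianDet F x ≠ 0) :
    (fderiv ℝ F x).IsInvertible := by
  have hinj : Function.Injective (fderiv ℝ F x).toLinearMap := by
    rw [← LinearMap.ker_eq_bot, LinearMap.ker_eq_bot']
    intro v hv
    have hv' : fderiv ℝ F x v = 0 := hv
    have e : v = v.1 • ((1, 0) : ℝ × ℝ) + v.2 • ((0, 1) : ℝ × ℝ) := by ext <;> simp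
    rw [e, map_add, map_smul, map_smul] at hv'
    have h0 := congrArg (fun w : Plane => w 0) hv'
    have h1 := congrArg (fun w : Plane => w 1) hv'
    simp only [PiLp.add_apply, PiLp.smul_apply, smul_eq_mul, PiLp.zero_apply] at h0 h1
    have e1 : jacobianDet F x * v.1 = 0 := by
      unfold jacobianDet
      linear_combination (fderiv ℝ F x (0, 1)) 1 * h0 - (fderiv ℝ F x (0, 1)) 0 * h1
    have e2 : jacobianDet F x * v.2 = 0 := by
      unfold jacobianDet
      linear_combination (fderiv ℝ F x (1, 0)) 0 * h1 - (fderiv ℝ F x (1, 0)) 1 * h0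
    exact Prod.ext ((mul_eq_zero.1 e1).resolve_left h) ((mul_eq_zero.1 e2).resolve_left h)
  let e := LinearMap.linearEquivOfInjective (fderiv ℝ F x).toLinearMap hinj (by simp)
  exact ⟨e.toContinuousLinearEquiv, by ext1 <;> rfl⟩

/-- A map whose increments are given exactly by its derivative at the midpoint is injective on a
convex set if its derivative is invertible there. -/
theorem injOn_of_midpoint {F : ℝ × ℝ → Plane} {D : Set (ℝ × ℝ)} (hD : Convex ℝ D)
    (hF : ∀ x ∈ D, (fderiv ℝ F x).IsInvertible)
    (h : ∀ x y, F x - F y = fderiv ℝ F ((1 / 2 : ℝ) • x + (1 / 2 : ℝ) • y) (x - y)) :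
    InjOn F D := by
  intro x hx y hy hxy
  have hm := hF _ (hD hx hy (by norm_num : (0 : ℝ) ≤ 1 / 2) (by norm_num : (0 : ℝ) ≤ 1 / 2)
    (by norm_num))
  have h1 := inverse_apply_fderiv hm (x - y)
  rw [← h, hxy, sub_self, map_zero] at h1
  exact (sub_eq_zero.1 h1.symm)

theorem triangleMap_sub (C : Fin 3 → Plane) (x y : ℝ × ℝ) : triangleMap C x - triangleMap C y
    = fderiv ℝ (triangleMap C) ((1 / 2 : ℝ) • x + (1 / 2 : ℝ) • y) (x - y) := by
  rw [fderiv_triangleMap]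
  simp only [triangleMap, Prod.fst_sub, Prod.snd_sub]
  module

theorem quadMap_sub (C : Fin 4 → Plane) (x y : ℝ × ℝ) : quadMap C x - quadMap C y
    = fderiv ℝ (quadMap C) ((1 / 2 : ℝ) • x + (1 / 2 : ℝ) • y) (x - y) := by
  rw [fderiv_quadMap]
  simp only [quadMap, Prod.fst_sub, Prod.snd_sub, Prod.fst_add, Prod.snd_add, Prod.smul_fst,
    Prod.smul_snd, smul_eq_mul]
  module

/-! ### The reference domains -/

theorem convex_refSquare : Convex ℝ refSquare := (convex_Icc _ _).prod (convex_Icc _ _)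

theorem isCompact_refSquare : IsCompact refSquare := isCompact_Icc.prod isCompact_Icc

theorem interior_refSquare : interior refSquare = Ioo (0 : ℝ) 1 ×ˢ Ioo (0 : ℝ) 1 := by
  rw [refSquare, interior_prod_eq, interior_Icc]

theorem uniqueDiffOn_refSquare : UniqueDiffOn ℝ refSquare :=
  (uniqueDiffOn_Icc zero_lt_one).prod (uniqueDiffOn_Icc zero_lt_one)

theorem mem_refTriangle {x : ℝ × ℝ} :
    x ∈ refTriangle ↔ 0 ≤ x.1 ∧ 0 ≤ x.2 ∧ x.1 + x.2 ≤ 1 := by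
  constructor
  · rintro ⟨⟨h1, h2⟩, h3, h4⟩
    exact ⟨h1, h3, by linarith⟩
  · rintro ⟨h1, h2, h3⟩
    exact ⟨⟨h1, by linarith⟩, h2, by linarith⟩

theorem convex_refTriangle : Convex ℝ refTriangle := by
  intro x hx y hy a b ha hb hab
  rw [mem_refTriangle] at *
  obtain ⟨x1, x2, x3⟩ := hx
  obtain ⟨y1, y2, y3⟩ := hy
  simp only [Prod.fst_add, Prod.snd_add, Prod.smul_fst, Prod.smul_snd, smul_eq_mul]
  refine ⟨by positivity, by positivity, ?_⟩
  calc a * x.1 + b * y.1 + (a * x.2 + b * y.2) = a * (x.1 + x.2) + b * (y.1 + y.2) := by ring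
    _ ≤ a * 1 + b * 1 := by gcongr
    _ = 1 := by linarith

theorem mem_interior_refTriangle {x : ℝ × ℝ} (h1 : 0 < x.1) (h2 : 0 < x.2)
    (h3 : x.1 + x.2 < 1) : x ∈ interior refTriangle := by
  have ho : IsOpen {x : ℝ × ℝ | 0 < x.1 ∧ 0 < x.2 ∧ x.1 + x.2 < 1} :=
    (isOpen_lt continuous_const continuous_fst).inter
      ((isOpen_lt continuous_const continuous_snd).inter
        (isOpen_lt (continuous_fst.add continuous_snd) continuous_const))
  refine interior_maximal (fun y hy => ?_) ho ⟨h1, h2, h3⟩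
  obtain ⟨y1, y2, y3⟩ := hy
  exact mem_refTriangle.2 ⟨y1.le, y2.le, y3.le⟩

theorem isCompact_refTriangle : IsCompact refTriangle := by
  refine isCompact_refSquare.of_isClosed_subset ?_ ?_
  · have : refTriangle = {x : ℝ × ℝ | 0 ≤ x.1 ∧ 0 ≤ x.2 ∧ x.1 + x.2 ≤ 1} := by
      ext x
      exact mem_refTriangle
    rw [this]
    exact (isClosed_le continuous_const continuous_fst).inter
      ((isClosed_le continuous_const continuous_snd).inter
        (isClosed_le (continuous_fst.add continuous_snd) continuous_const))
  · intro x hx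
    obtain ⟨h1, h2, h3⟩ := mem_refTriangle.1 hx
    exact ⟨⟨h1, by linarith⟩, h2, by linarith⟩

theorem uniqueDiffOn_refTriangle : UniqueDiffOn ℝ refTriangle :=
  uniqueDiffOn_convex convex_refTriangle
    ⟨(1 / 3, 1 / 3), mem_interior_refTriangle (by norm_num) (by norm_num) (by norm_num)⟩

theorem triangleCorner_mem (j : Fin 3) : triangleCorner j ∈ refTriangle := by
  rw [mem_refTriangle]
  fin_cases j <;> simp [triangleCorner]

theorem squareCorner_mem (j : Fin 4) : squareCorner j ∈ refSquare := by
  fin_cases j <;> simp [squareCorner, refSquare]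

theorem triangleMap_corner (C : Fin 3 → Plane) (j : Fin 3) :
    triangleMap C (triangleCorner j) = C j := by
  fin_cases j <;> simp [triangleMap, triangleCorner]

theorem quadMap_corner (C : Fin 4 → Plane) (j : Fin 4) :
    quadMap C (squareCorner j) = C j := by
  fin_cases j <;> simp [quadMap, squareCorner]

theorem triangleMap_side (C : Fin 3 → Plane) (j : Fin 3) (t : ℝ) :
    triangleMap C ((1 - t) • triangleCorner j + t • triangleCorner (j + 1))
      = (1 - t) • C j + t • C (j + 1) := by
  fin_cases j <;> simp [triangleMap, triangleCorner]
  abel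

theorem quadMap_side (C : Fin 4 → Plane) (j : Fin 4) (t : ℝ) :
    quadMap C ((1 - t) • squareCorner j + t • squareCorner (j + 1))
      = (1 - t) • C j + t • C (j + 1) := by
  fin_cases j <;> simp [quadMap, squareCorner]
  abel

/-- Consecutive corners of the square differ in exactly one coordinate. -/
theorem squareCorner_succ (j : Fin 4) : squareCorner j ≠ squareCorner (j + 1) ∧
    ((squareCorner j).1 = (squareCorner (j + 1)).1 ∨
      (squareCorner j).2 = (squareCorner (j + 1)).2) := by
  fin_cases j <;> simp [squareCorner]

theorem refTriangle_decomp {x : ℝ × ℝ} (hx : x ∈ refTriangle) : x ∈ interior refTriangle ∨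
    (∃ j, ∃ t ∈ Ioo (0 : ℝ) 1, x = (1 - t) • triangleCorner j + t • triangleCorner (j + 1)) ∨
    ∃ j, x = triangleCorner j := by
  obtain ⟨h1, h2, h3⟩ := mem_refTriangle.1 hx
  obtain ⟨u, v⟩ := x
  simp only at h1 h2 h3
  rcases h1.eq_or_lt with rfl | h1
  · rcases h2.eq_or_lt with rfl | h2
    · exact Or.inr (Or.inr ⟨0, rfl⟩)
    rcases (by linarith : v ≤ 1).eq_or_lt with rfl | h4
    · exact Or.inr (Or.inr ⟨2, rfl⟩)
    · refine Or.inr (Or.inl ⟨2, 1 - v, ⟨by linarith, by linarith⟩, ?_⟩)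
      simp [triangleCorner]
  rcases h2.eq_or_lt with rfl | h2
  · rcases (by linarith : u ≤ 1).eq_or_lt with rfl | h4
    · exact Or.inr (Or.inr ⟨1, rfl⟩)
    · refine Or.inr (Or.inl ⟨0, u, ⟨h1, h4⟩, ?_⟩)
      simp [triangleCorner]
  rcases h3.eq_or_lt with h3 | h3
  · refine Or.inr (Or.inl ⟨1, v, ⟨h2, by linarith⟩, ?_⟩)
    obtain rfl : u = 1 - v := by linarith
    simp [triangleCorner]
  · exact Or.inl (mem_interior_refTriangle h1 h2 h3)

theorem refSquare_decomp {x : ℝ × ℝ} (hx : x ∈ refSquare) : x ∈ interior refSquare ∨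
    (∃ j, ∃ t ∈ Ioo (0 : ℝ) 1, x = (1 - t) • squareCorner j + t • squareCorner (j + 1)) ∨
    ∃ j, x = squareCorner j := by
  obtain ⟨u, v⟩ := x
  obtain ⟨⟨u0, u1⟩, v0, v1⟩ := hx
  simp only at u0 u1 v0 v1
  rw [interior_refSquare]
  rcases u0.eq_or_lt with rfl | u0
  · rcases v0.eq_or_lt with rfl | v0
    · exact Or.inr (Or.inr ⟨0, rfl⟩)
    rcases v1.eq_or_lt with rfl | v1
    · exact Or.inr (Or.inr ⟨3, rfl⟩)
    refine Or.inr (Or.inl ⟨3, 1 - v, ⟨by linarith, by linarith⟩, ?_⟩)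
    simp [squareCorner]
  rcases u1.eq_or_lt with rfl | u1
  · rcases v0.eq_or_lt with rfl | v0
    · exact Or.inr (Or.inr ⟨1, rfl⟩)
    rcases v1.eq_or_lt with rfl | v1
    · exact Or.inr (Or.inr ⟨2, rfl⟩)
    refine Or.inr (Or.inl ⟨1, v, ⟨v0, v1⟩, ?_⟩)
    simp [squareCorner]
  rcases v0.eq_or_lt with rfl | v0
  · refine Or.inr (Or.inl ⟨0, u, ⟨u0, u1⟩, ?_⟩)
    simp [squareCorner]
  rcases v1.eq_or_lt with rfl | v1
  · refine Or.inr (Or.inl ⟨2, 1 - u, ⟨by linarith, by linarith⟩, ?_⟩)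
    simp [squareCorner]
  exact Or.inl ⟨⟨u0, u1⟩, v0, v1⟩

/-! ### Normal derivatives along the sides of an element -/

theorem exists_normal_tri {p : ℕ} {C : Fin 3 → Plane} {f : ℝ × ℝ → ℝ}
    (hf : f ∈ polySpace (totExp p)) (A B : ℝ × ℝ) (n : Plane) :
    ∃ q : Polynomial ℝ, q.natDegree ≤ p - 1 ∧ ∀ t : ℝ,
      grad (triangleMap C) f ((1 - t) • A + t • B) n = q.eval t := by
  obtain ⟨-, q, hq, h⟩ := tot_le_derivTraceSpace p A B
    ((fderiv ℝ (triangleMap C) 0).inverse n) hf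
  refine ⟨q, hq, fun t => ?_⟩
  have e : fderiv ℝ (triangleMap C) ((1 - t) • A + t • B) = fderiv ℝ (triangleMap C) 0 :=
    ContinuousLinearMap.ext fun v => by rw [fderiv_triangleMap, fderiv_triangleMap]
  rw [← h, grad, e]
  rfl

/-- Along a side of a quadrilateral, the normal derivative is the quotient of a polynomial of
degree at most `p` and the affine Jacobian determinant. Hence it is a polynomial of degree at
most `p - 1` if a single linear functional vanishes. -/
theorem exists_normal_quad {p : ℕ} (hp : 1 ≤ p) {C : Fin 4 → Plane}
    (hC : RegularOn (quadMap C) refSquare) {A B : ℝ × ℝ} (hA : A ∈ refSquare)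
    (hB : B ∈ refSquare) (hne : A ≠ B) (hAB : A.1 = B.1 ∨ A.2 = B.2) (n : Plane) :
    ∃ L : polySpace (biExp p) →ₗ[ℝ] ℝ, ∀ f, L f = 0 →
      ∃ q : Polynomial ℝ, q.natDegree ≤ p - 1 ∧ ∀ t ∈ Ioo (0 : ℝ) 1,
        grad (quadMap C) f.1 ((1 - t) • A + t • B) n = q.eval t := by
  set b : ℝ × ℝ := B - A with hb
  set x : ℝ → ℝ × ℝ := fun t => (1 - t) • A + t • B with hx
  have hxmem : ∀ t ∈ Icc (0 : ℝ) 1, x t ∈ refSquare := fun t ht =>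
    convex_refSquare hA hB (sub_nonneg.2 ht.2) ht.1 (by ring)
  have hx1 : ∀ t, (x t).1 = A.1 + t * b.1 := fun t => by
    simp [hx, hb]
    ring
  have hx2 : ∀ t, (x t).2 = A.2 + t * b.2 := fun t => by
    simp [hx, hb]
    ring
  have hb0 : b.1 = 0 ∨ b.2 = 0 := by
    rcases hAB with h | h
    · exact Or.inl (by simp [hb, h])
    · exact Or.inr (by simp [hb, h])
  have hbne : b.1 * b.1 - b.2 * b.2 ≠ 0 := by
    have hbz : b ≠ 0 := sub_ne_zero.2 hne.symm
    rcases hb0 with h | h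
    · have : b.2 ≠ 0 := fun h' => hbz (Prod.ext h h')
      simp [h, this]
    · have : b.1 ≠ 0 := fun h' => hbz (Prod.ext h' h)
      simp [h, this]
  -- The image of the side has the constant direction `d`; the image of the transversal
  -- direction is affine in `t`.
  set d : Plane := fderiv ℝ (quadMap C) A b with hd
  set m0 : Plane := fderiv ℝ (quadMap C) A b.swap with hm0
  set m1 : Plane := (b.1 * b.1 + b.2 * b.2) • (C 0 - C 1 + C 2 - C 3) with hm1
  have hLd : ∀ t, fderiv ℝ (quadMap C) (x t) b = d := fun t => by
    rw [hd, fderiv_quadMap, fderiv_quadMap, hx1, hx2]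
    rcases hb0 with h | h <;> rw [h] <;> module
  have hLm : ∀ t, fderiv ℝ (quadMap C) (x t) b.swap = m0 + t • m1 := fun t => by
    rw [hm0, fderiv_quadMap, fderiv_quadMap, hx1, hx2, hm1]
    simp only [Prod.fst_swap, Prod.snd_swap]
    module
  have hJ : ∀ t ∈ Icc (0 : ℝ) 1,
      (d 0 * m0 1 - d 1 * m0 0) + (d 0 * m1 1 - d 1 * m1 0) * t ≠ 0 := by
    intro t ht
    have hj := hC _ (hxmem t ht)
    have e : (d 0 * m0 1 - d 1 * m0 0) + (d 0 * m1 1 - d 1 * m1 0) * t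
        = jacobianDet (quadMap C) (x t) * (b.1 * b.1 - b.2 * b.2) := by
      have e1 : (d 0 * m0 1 - d 1 * m0 0) + (d 0 * m1 1 - d 1 * m1 0) * t
          = d 0 * (m0 + t • m1) 1 - d 1 * (m0 + t • m1) 0 := by
        simp only [PiLp.add_apply, PiLp.smul_apply, smul_eq_mul]
        ring
      have e2 : ∀ v : ℝ × ℝ, fderiv ℝ (quadMap C) (x t) v
          = v.1 • fderiv ℝ (quadMap C) (x t) (1, 0)
            + v.2 • fderiv ℝ (quadMap C) (x t) (0, 1) := fun v => by
        rw [← map_smul, ← map_smul, ← map_add]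
        congr 1
        ext <;> simp
      rw [e1, ← hLm, ← hLd t, e2 b, e2 b.swap, jacobianDet]
      simp only [PiLp.add_apply, PiLp.smul_apply, smul_eq_mul, Prod.fst_swap, Prod.snd_swap]
      ring
    rw [e]
    exact mul_ne_zero hj hbne
  obtain ⟨L, hL⟩ := exists_functional_dvd hp (α := d 0 * m0 1 - d 1 * m0 0)
    (β := d 0 * m1 1 - d 1 * m1 0) (Or.inl (by simpa using hJ 0 (by simp)))
  let N : polySpace (biExp p) →ₗ[ℝ] (ℝ → ℝ) :=
    { toFun := fun f t => ((n 0 * m0 1 - n 1 * m0 0) + (n 0 * m1 1 - n 1 * m1 0) * t)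
          * fderiv ℝ f.1 (x t) b + (d 0 * n 1 - d 1 * n 0) * fderiv ℝ f.1 (x t) b.swap
      map_add' := fun f g => by
        ext t
        have hf := (contDiff_polySpace f.2).differentiable (by norm_num) (x t)
        have hg := (contDiff_polySpace g.2).differentiable (by norm_num) (x t)
        simp only [Submodule.coe_add, fderiv_add hf hg, add_apply, Pi.add_apply]
        ring
      map_smul' := fun c f => by
        ext t
        have hf := (contDiff_polySpace f.2).differentiable (by norm_num) (x t)
        simp only [Submodule.coe_smul, fderiv_const_smul hf, smul_apply, Pi.smul_apply,
          smul_eq_mul, RingHom.id_apply]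
        ring }
  refine ⟨L.comp N, fun f hf0 => ?_⟩
  have hfd := (contDiff_polySpace f.2).differentiable (by norm_num)
  obtain ⟨q0, hq0, h0⟩ := bi_le_traceSpace p hAB f.2
  obtain ⟨-, q2, hq2, h2⟩ := bi_le_derivTraceSpace p hAB b.swap f.2
  have h1 : ∀ t, fderiv ℝ f.1 (x t) b = q0.derivative.eval t := fun t => by
    have e1 : HasDerivAt (fun t => f.1 (x t)) (fderiv ℝ f.1 (x t) b) t :=
      (hfd (x t)).hasFDerivAt.comp_hasDerivAt t (hasDerivAt_segment A B t)
    have e2 : (fun t => f.1 (x t)) = fun t => q0.eval t := funext h0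
    rw [e2] at e1
    exact e1.unique (q0.hasDerivAt t)
  set Q : Polynomial ℝ := (Polynomial.C (n 0 * m1 1 - n 1 * m1 0) * Polynomial.X
    + Polynomial.C (n 0 * m0 1 - n 1 * m0 0)) * q0.derivative
    + Polynomial.C (d 0 * n 1 - d 1 * n 0) * q2 with hQ
  have hQdeg : Q.natDegree ≤ p := by
    refine (Polynomial.natDegree_add_le _ _).trans (max_le ?_ ?_)
    · have e1 := Polynomial.natDegree_derivative_le q0
      refine Polynomial.natDegree_mul_le.trans ?_
      have e2 : (Polynomial.C (n 0 * m1 1 - n 1 * m1 0) * Polynomial.X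
        + Polynomial.C (n 0 * m0 1 - n 1 * m0 0)).natDegree ≤ 1 :=
        Polynomial.natDegree_linear_le
      omega
    · exact (Polynomial.natDegree_C_mul_le _ _).trans hq2
  have hN : N f = fun t => Q.eval t := by
    ext t
    change (_ + _ * t) * fderiv ℝ f.1 (x t) b + _ * fderiv ℝ f.1 (x t) b.swap = _
    rw [h1, h2 t, hQ]
    simp only [Polynomial.eval_add, Polynomial.eval_mul, Polynomial.eval_C, Polynomial.eval_X]
    ring
  obtain ⟨q, hq, hqe⟩ := hL Q hQdeg (by rw [← hN]; exact hf0)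
  refine ⟨q, hq, fun t ht => ?_⟩
  have htI := Ioo_subset_Icc_self ht
  have hinv := isInvertible_of_jacobianDet (hC _ (hxmem t htI))
  have e1 := grad_apply_fderiv f.1 hinv b
  have e2 := grad_apply_fderiv f.1 hinv b.swap
  rw [hLd] at e1
  rw [hLm] at e2
  -- Cramer's rule expresses the normal in terms of the two image directions.
  have cramer : ((d 0 * m0 1 - d 1 * m0 0) + (d 0 * m1 1 - d 1 * m1 0) * t) • n
      = ((n 0 * m0 1 - n 1 * m0 0) + (n 0 * m1 1 - n 1 * m1 0) * t) • d
        + (d 0 * n 1 - d 1 * n 0) • (m0 + t • m1) := by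
    ext i
    fin_cases i <;> simp <;> ring
  have e3 := congrArg (grad (quadMap C) f.1 (x t)) cramer
  rw [map_add, map_smul, map_smul, map_smul, e1, e2] at e3
  refine mul_left_cancel₀ (hJ t htI) ?_
  rw [← hqe]
  exact e3.trans (congrFun hN t)

/-! ### Triangles and quadrilaterals of a mesh as elements -/

section MeshElements

variable {ιV ιE ιT ιQ : Type*} {M : MeshData ιV ιE ιT ιQ} {Ω : Set Plane} {p : ℕ}

/-- For a polygon with corners `V`, the mesh edges forming its sides, with the two corners `st j`
and `en j` at which the edge of side `j` starts and ends. The reparametrization `τ j`, which is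
`t` or `1 - t`, compares the direction of the edge to the cyclic order of the corners. -/
structure Sides (M : MeshData ιV ιE ιT ιQ) {n : ℕ} [NeZero n] (V : Fin n → ιV) where
  st : Fin n → Fin n
  en : Fin n → Fin n
  k : Fin n → ιE
  τ : Fin n → ℝ → ℝ
  vtx_st : ∀ j, V (st j) = M.edgeEnd (k j) 0
  vtx_en : ∀ j, V (en j) = M.edgeEnd (k j) 1
  cases : ∀ j, (st j = j ∧ en j = j + 1 ∧ τ j = fun t => t) ∨
    (st j = j + 1 ∧ en j = j ∧ τ j = fun t => 1 - t)

namespace Sides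

variable {n : ℕ} [NeZero n] {V : Fin n → ιV}

theorem nonempty (hM : M.IsMixedMesh Ω)
    (h : ∀ j, ∃ k, M.edge k = openSegment ℝ (M.vertex (V j)) (M.vertex (V (j + 1)))) :
    Nonempty (Sides M V) := by
  have key : ∀ j, ∃ st en : Fin n, ∃ k, ∃ τ : ℝ → ℝ, V st = M.edgeEnd k 0 ∧
      V en = M.edgeEnd k 1 ∧ ((st = j ∧ en = j + 1 ∧ τ = fun t => t) ∨
        (st = j + 1 ∧ en = j ∧ τ = fun t => 1 - t)) := by
    intro j
    obtain ⟨k, hk⟩ := h j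
    rcases hM.edgeEnd_eq hk with ⟨h0, h1⟩ | ⟨h1, h0⟩
    · exact ⟨j, j + 1, k, _, h0, h1, Or.inl ⟨rfl, rfl, rfl⟩⟩
    · exact ⟨j + 1, j, k, _, h0, h1, Or.inr ⟨rfl, rfl, rfl⟩⟩
  choose st en k τ h1 h2 h3 using key
  exact ⟨⟨st, en, k, τ, h1, h2, h3⟩⟩

theorem segment_eq (o : Sides M V) {X : Type*} [AddCommGroup X] [Module ℝ X] (c : Fin n → X)
    (j : Fin n) (t : ℝ) : (1 - t) • c (o.st j) + t • c (o.en j)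
      = (1 - o.τ j t) • c j + o.τ j t • c (j + 1) := by
  rcases o.cases j with ⟨h1, h2, h3⟩ | ⟨h1, h2, h3⟩
  · rw [h1, h2, h3]
  · rw [h1, h2, h3]
    module

theorem τ_τ (o : Sides M V) (j : Fin n) (t : ℝ) : o.τ j (o.τ j t) = t := by
  rcases o.cases j with ⟨-, -, h3⟩ | ⟨-, -, h3⟩ <;> simp [h3]

theorem τ_mem_Icc (o : Sides M V) (j : Fin n) {t : ℝ} (ht : t ∈ Icc (0 : ℝ) 1) :
    o.τ j t ∈ Icc (0 : ℝ) 1 := by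
  rcases o.cases j with ⟨-, -, h3⟩ | ⟨-, -, h3⟩
  · rwa [h3]
  · rw [h3]
    exact ⟨by linarith [ht.2], by linarith [ht.1]⟩

theorem τ_mem_Ioo (o : Sides M V) (j : Fin n) {t : ℝ} (ht : t ∈ Ioo (0 : ℝ) 1) :
    o.τ j t ∈ Ioo (0 : ℝ) 1 := by
  rcases o.cases j with ⟨-, -, h3⟩ | ⟨-, -, h3⟩
  · rwa [h3]
  · rw [h3]
    exact ⟨by linarith [ht.2], by linarith [ht.1]⟩

theorem segment_eq' (o : Sides M V) {X : Type*} [AddCommGroup X] [Module ℝ X] (c : Fin n → X)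
    (j : Fin n) (t : ℝ) : (1 - t) • c j + t • c (j + 1)
      = (1 - o.τ j t) • c (o.st j) + o.τ j t • c (o.en j) := by
  rw [o.segment_eq, o.τ_τ]

theorem edgePoint_eq (o : Sides M V) (j : Fin n) (t : ℝ) : M.edgePoint (o.k j) t
    = (1 - o.τ j t) • M.vertex (V j) + o.τ j t • M.vertex (V (j + 1)) := by
  rw [MeshData.edgePoint, ← o.vtx_st, ← o.vtx_en]
  exact o.segment_eq (fun j => M.vertex (V j)) j t

end Sides

theorem finrank_tri (hp : 5 ≤ p) : Module.finrank ℝ (polySpace (totExp p))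
    = 3 * 6 + (3 * ((p - 5) + (p - 4)) + (Fintype.card (Fin ((p - 4).choose 2)) + 0)) := by
  obtain ⟨k, rfl⟩ := Nat.exists_eq_add_of_le' hp
  have h1 := finrank_tot (k + 5)
  have h2 := Nat.add_one_mul_choose_eq k 1
  rw [Nat.choose_one_right] at h2
  rw [Fintype.card_fin, show k + 5 - 5 = k by omega, show k + 5 - 4 = k + 1 by omega]
  simp only [Nat.reduceAdd] at h2
  nlinarith

theorem finrank_quad (hp : 5 ≤ p) : Module.finrank ℝ (polySpace (biExp p))
    = 4 * 6 + (4 * ((p - 5) + (p - 4)) + (Fintype.card (Fin (p - 3) × Fin (p - 3)) + 4)) := by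
  obtain ⟨k, rfl⟩ := Nat.exists_eq_add_of_le' hp
  rw [finrank_bi, Fintype.card_prod, Fintype.card_fin, show k + 5 - 5 = k by omega,
    show k + 5 - 4 = k + 1 by omega, show k + 5 - 3 = k + 2 by omega]
  ring

/-- A triangle of the mesh as an element. -/
def triElem (hM : M.IsMixedMesh Ω) (hp : 5 ≤ p) (P : M.InterpPoints p) (i : ιT)
    (o : Sides M (M.triCorner i)) : Elem M p where
  F := M.triMap i
  D := refTriangle
  smooth := contDiff_triangleMap _
  compact := isCompact_refTriangle
  uniqueDiff := uniqueDiffOn_refTriangle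
  invertible x hx := isInvertible_of_jacobianDet (hM.tri_regular i x hx)
  inj := injOn_of_midpoint convex_refTriangle
    (fun x hx => isInvertible_of_jacobianDet (hM.tri_regular i x hx)) (triangleMap_sub _)
  n := 3
  corner := triangleCorner
  corner_mem := triangleCorner_mem
  vtx := M.triCorner i
  map_corner := triangleMap_corner _
  st := o.st
  en := o.en
  edgeIdx := o.k
  vtx_st := o.vtx_st
  vtx_en := o.vtx_en
  side_mem j t ht := convex_refTriangle (triangleCorner_mem _) (triangleCorner_mem _)
    (sub_nonneg.2 ht.2) ht.1 (by ring)
  map_side j t := by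
    rw [o.segment_eq, o.edgePoint_eq]
    exact triangleMap_side _ j _
  decomp x hx := by
    rcases refTriangle_decomp hx with h | ⟨j, t, ht, h⟩ | h
    · exact Or.inl h
    · exact Or.inr (Or.inl ⟨j, o.τ j t, o.τ_mem_Ioo j ht, by rw [h, o.segment_eq']⟩)
    · exact Or.inr (Or.inr h)
  κ := Fin ((p - 4).choose 2)
  fintypePt := inferInstance
  pt := P.T i
  pt_mem := P.T_mem i
  Pol := polySpace (totExp p)
  finite_pol := finite_polySpace
  smooth_pol f hf := contDiff_polySpace hf
  trace_pol f hf j := tot_le_traceSpace p _ _ hf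
  unisolvent_pol f hf h hpt := by
    refine P.T_unisolvent i f (mem_interiorTri hf fun j t ht => ?_) 0 (Submodule.zero_mem _) hpt
    rw [o.segment_eq']
    exact h j _ (o.τ_mem_Icc j ht)
  m := 0
  lam := Fin.elim0
  normal_pol f _ j := by
    obtain ⟨q, hq, h⟩ := exists_normal_tri (C := fun j => M.vertex (M.triCorner i j)) f.2
      (triangleCorner (o.st j)) (triangleCorner (o.en j)) (M.normal (o.k j))
    exact ⟨q, hq, fun t _ => h t⟩
  finrank_pol := finrank_tri hp

theorem exists_normal_quad_sides (hM : M.IsMixedMesh Ω) (hp : 5 ≤ p) (i : ιQ)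
    (o : Sides M (M.quadCorner i)) : ∃ lam : Fin 4 → polySpace (biExp p) →ₗ[ℝ] ℝ,
      ∀ f : polySpace (biExp p), (∀ j, lam j f = 0) → ∀ j, ∃ q : Polynomial ℝ,
        q.natDegree ≤ p - 1 ∧ ∀ t ∈ Ioo (0 : ℝ) 1, grad (M.quaMap i) f.1
          ((1 - t) • squareCorner (o.st j) + t • squareCorner (o.en j)) (M.normal (o.k j))
            = q.eval t := by
  have hadj : ∀ j, squareCorner (o.st j) ≠ squareCorner (o.en j) ∧
      ((squareCorner (o.st j)).1 = (squareCorner (o.en j)).1 ∨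
        (squareCorner (o.st j)).2 = (squareCorner (o.en j)).2) := by
    intro j
    have h := squareCorner_succ j
    rcases o.cases j with ⟨h1, h2, -⟩ | ⟨h1, h2, -⟩
    · rwa [h1, h2]
    · rw [h1, h2]
      exact ⟨h.1.symm, h.2.imp Eq.symm Eq.symm⟩
  choose lam hlam using fun j => exists_normal_quad (p := p) (by omega) (hM.quad_regular i)
    (squareCorner_mem (o.st j)) (squareCorner_mem (o.en j)) (hadj j).1 (hadj j).2
    (M.normal (o.k j))
  exact ⟨lam, fun f hf j => hlam j f (hf j)⟩

/-- A quadrilateral of the mesh as an element. -/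
def quadElem (hM : M.IsMixedMesh Ω) (hp : 5 ≤ p) (P : M.InterpPoints p) (i : ιQ)
    (o : Sides M (M.quadCorner i)) : Elem M p where
  F := M.quaMap i
  D := refSquare
  smooth := contDiff_quadMap _
  compact := isCompact_refSquare
  uniqueDiff := uniqueDiffOn_refSquare
  invertible x hx := isInvertible_of_jacobianDet (hM.quad_regular i x hx)
  inj := injOn_of_midpoint convex_refSquare
    (fun x hx => isInvertible_of_jacobianDet (hM.quad_regular i x hx)) (quadMap_sub _)
  n := 4
  corner := squareCorner
  corner_mem := squareCorner_mem
  vtx := M.quadCorner i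
  map_corner := quadMap_corner _
  st := o.st
  en := o.en
  edgeIdx := o.k
  vtx_st := o.vtx_st
  vtx_en := o.vtx_en
  side_mem j t ht := convex_refSquare (squareCorner_mem _) (squareCorner_mem _)
    (sub_nonneg.2 ht.2) ht.1 (by ring)
  map_side j t := by
    rw [o.segment_eq, o.edgePoint_eq]
    exact quadMap_side _ j _
  decomp x hx := by
    rcases refSquare_decomp hx with h | ⟨j, t, ht, h⟩ | h
    · exact Or.inl h
    · exact Or.inr (Or.inl ⟨j, o.τ j t, o.τ_mem_Ioo j ht, by rw [h, o.segment_eq']⟩)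
    · exact Or.inr (Or.inr h)
  κ := Fin (p - 3) × Fin (p - 3)
  fintypePt := inferInstance
  pt := P.Q i
  pt_mem := P.Q_mem i
  Pol := polySpace (biExp p)
  finite_pol := finite_polySpace
  smooth_pol f hf := contDiff_polySpace hf
  trace_pol f hf j := by
    have h := squareCorner_succ j
    rcases o.cases j with ⟨h1, h2, -⟩ | ⟨h1, h2, -⟩
    · rw [h1, h2]
      exact bi_le_traceSpace p h.2 hf
    · rw [h1, h2]
      exact bi_le_traceSpace p (h.2.imp Eq.symm Eq.symm) hf
  unisolvent_pol f hf h hpt := by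
    refine P.Q_unisolvent i f (mem_interiorQuad hf fun j t ht => ?_) 0 (Submodule.zero_mem _) hpt
    rw [o.segment_eq']
    exact h j _ (o.τ_mem_Icc j ht)
  m := 4
  lam := (exists_normal_quad_sides hM hp i o).choose
  normal_pol := (exists_normal_quad_sides hM hp i o).choose_spec
  finrank_pol := finrank_quad hp

end MeshElements

end ArgyrisLike

end

theorem mainTheorem1 {ιV ιE ιT ιQ : Type*} [Finite ιV] [Finite ιE] [Finite ιT] [Finite ιQ]
    (M : ArgyrisLike.MeshData ιV ιE ιT ιQ) (Ω : Set Plane) (hM : M.IsMixedMesh Ω)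
    (p : ℕ) (hp : 5 ≤ p) (P : M.InterpPoints p)
    (s : ArgyrisLike.MeshData.InterpValues ιV ιE ιT ιQ p) :
    ∃ φ : Plane → ℝ, (M.MemArgyris Ω p φ ∧ M.Interpolates Ω P s φ) ∧
      ∀ ψ : Plane → ℝ, M.MemArgyris Ω p ψ → M.Interpolates Ω P s ψ →
        Set.EqOn ψ φ (closure Ω) := by
  have oT : ∀ i, ArgyrisLike.Sides M (M.triCorner i) := fun i =>
    (ArgyrisLike.Sides.nonempty hM (hM.tri_side i)).some
  have oQ : ∀ i, ArgyrisLike.Sides M (M.quadCorner i) := fun i =>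
    (ArgyrisLike.Sides.nonempty hM (hM.quad_side i)).some
  let el : ιT ⊕ ιQ → ArgyrisLike.Elem M p := Sum.elim
    (fun i => ArgyrisLike.triElem hM hp P i (oT i))
    (fun i => ArgyrisLike.quadElem hM hp P i (oQ i))
  have hel : ArgyrisLike.Parametrizes M el := by
    rintro (i | i) <;> rfl
  let τ : ∀ e, (el e).κ → ℝ := fun e => match e with
    | Sum.inl i => s.σT i
    | Sum.inr i => s.σQ i
  refine ArgyrisLike.existsUnique_of_elems hM hel hp P s τ (fun φ => ?_) (fun φ => ?_)
  · rw [Sum.forall]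
    exact and_congr (forall_congr' fun i => ArgyrisLike.isPolyTotal_iff)
      (forall_congr' fun i => ArgyrisLike.isPolyBi_iff)
  · rw [Sum.forall, and_comm]
    rfl
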